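/- **Setting.** Let $G$ be a graph whose $n$ vertices are the contexts, with an unknown vertex labelling $y$, and let there be $K\ge 1$ arms. Playing arm $i$ in context $c$ gives a reward drawn, independently of the past, from an unknown distribution $\nu_i^c$ on $[0,1]$ with mean $\mu_i^c$; contexts with the same label have the same reward distributions. Let $f$ be the cutsize, i.e. the number of edges of $G$ whose endpoints have different labels, and suppose $f\ge 1$. There are $T$ rounds; in round $t$ the learner receives a context $s_t$ (an arbitrary sequence; $s_t$ may even be chosen by an adversary that sees the past), plays an arm $I_t$ and observes its reward. The pseudo-regret is $\mathbb E\big[\sum_{t=1}^T\big(\max_i\mu_i^{s_t}-\mu_{I_t}^{s_t}\big)\big]$. Write $\Delta_i^c=\max_j\mu_j^c-\mu_i^c$. **Algorithm.** Place the contexts at positions $0,\dots,n-1$ of a line and let $L=\lceil\log_2 n\rceil$. For each level $p=1,\dots,L$, cut the line into blocks of $2^{L-p}$ consecutive positions, and let every block have its own copy of Tsallis-INF (power $1/2$, importance-weighted loss estimators): in its $t$-th round, with cumulative loss estimates $\hat L$, it draws the arm from the minimizer $w$ over the probability simplex of $\sum_i w_i\hat L_i-\frac4{\eta_t}\sum_i\sqrt{w_i}$,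 where $\eta_t=2/\sqrt t$, and after playing arm $I$ and observing reward $X$ it adds $(1-X)/w_I$ to $\hat L_I$. A context is handled by the active copy responsible for it: initially the copy at level $1$ is active, and a copy at a level $p<L$ is replaced by its two children at level $p+1$ once it has handled $D$ rounds. On a tree, the algorithm is run on a spine: the path formed by the sequence of vertices visited by a depth-first traversal (a closed walk crossing every edge exactly twice), each context being placed at one of the positions where it is visited, and $L$ being $\lceil\log_2\rceil$ of the number of positions of that path. **Theorem.** For all constants $\delta,a,b>0$ there is a constant $C>0$, depending only on $\delta,a,b$, such that the following holds for all $n,K,T,f,D$, labellings and reward distributions. Suppose that every context has a unique best arm, that all positive gaps satisfy $\Delta_i^c\ge\delta$ (so $\Delta_{\min}\ge\delta$), and that the integer $D$ is of order $\sqrt{TK/f}$, namely $$a\sqrt{TK/f}\le D\le b\,\max\{1,\sqrt{TK/f}\}.$$ 1. If $G$ is the line graph with vertices in the order of the line, the algorithm has pseudo-regret at most $C\sqrt{KTf}\,\log(nT)$, that is $\tilde O(\sqrt{KTf})$. 2. If $G$ is a tree, then it has a spine, and for every choice of spine and positions the algorithm run on it has pseudo-regret at most $C\sqrt{KTf}\,\log(nT)$,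 that is $\tilde O(\sqrt{KTf})$. -/

import Mathlib

open MeasureTheory

universe u v w

/-! ## The contextual bandit environment -/

/-- Mean reward of arm `i` in context `c`. -/
noncomputable def armMean {V : Type u} {K : ℕ} (ν : V → Fin K → Measure ℝ) (c : V) (i : Fin K) : ℝ :=
  ∫ x, x ∂(ν c i)

/-- Mean reward of the best arm in context `c`. -/
noncomputable def bestMean {V : Type u} {K : ℕ} (ν : V → Fin K → Measure ℝ) (c : V) : ℝ :=
  ⨆ i, armMean ν c i

/-- The gap of arm `i` in context `c`. -/
noncomputable def gap {V : Type u} {K : ℕ} (ν : V → Fin K → Measure ℝ) (c : V) (i : Fin K) : ℝ :=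
  bestMean ν c - armMean ν c i

/-- Every context-arm pair has a reward distribution that is a probability measure on `[0,1]`. -/
structure IsRewardModel {V : Type u} {K : ℕ} (ν : V → Fin K → Measure ℝ) : Prop where
  prob : ∀ c i, IsProbabilityMeasure (ν c i)
  mem_unit : ∀ c i, ∀ᵐ x ∂(ν c i), x ∈ Set.Icc (0 : ℝ) 1

/-- Contexts with the same label share their reward distributions. -/
def RespectsLabels {V : Type u} {Λ : Type v} {K : ℕ} (ν : V → Fin K → Measure ℝ) (y : V → Λ) : Prop :=
  ∀ c c', y c = y c' → ∀ i, ν c i = ν c' i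

/-- In every context the best arm is unique, and every positive gap is at least `δ`. -/
structure IsEasy {V : Type u} {K : ℕ} (ν : V → Fin K → Measure ℝ) (δ : ℝ) : Prop where
  unique_best : ∀ c, ∃! i, gap ν c i = 0
  le_gap : ∀ c i, 0 < gap ν c i → δ ≤ gap ν c i

/-- The number of edges whose endpoints have different labels. -/
noncomputable def cutsize {V : Type u} {Λ : Type v} (G : SimpleGraph V) (y : V → Λ) : ℕ :=
  {e : Sym2 V | ∃ c c', e = s(c, c') ∧ G.Adj c c' ∧ y c ≠ y c'}.ncard

/-! ## Algorithms and their interaction with the environment -/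

/-- A randomized algorithm: from the past (context, arm played, reward observed), oldest round
first, and the current context, it computes the probability of playing each arm. -/
abbrev Policy (V : Type u) (K : ℕ) := List (V × Fin K × ℝ) → V → Fin K → ℝ

/-- The record of the rounds `0, …, t - 1`. -/
def history {V : Type u} {K : ℕ} {Ω : Type w} (ctx : ℕ → Ω → V) (arm : ℕ → Ω → Fin K)
    (rew : ℕ → Ω → ℝ) (t : ℕ) (ω : Ω) : List (V × Fin K × ℝ) :=
  (List.range t).map fun s => (ctx s ω, arm s ω, rew s ω)

/-- On the probability space `(Ω, P)`, the contexts `ctx t`, the arms `arm t` and the observed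
rewards `rew t`, for `t = 0, …, T - 1`, come from playing the policy `π` in the environment `ν`.
The σ-algebra `ℱ t` is what is known just before the arm of round `t` is drawn: it contains the
past rounds and the current context, which may thus be chosen by an adversary that
sees the past (a fixed sequence of contexts is the case of constant functions `ctx t`).
Conditionally on `ℱ t`, the arm is drawn from the distribution given by the policy, and the reward
is drawn from the distribution of that arm in that context. -/
structure IsInteraction {V : Type u} {K : ℕ} {Ω : Type w} [mΩ : MeasurableSpace Ω] (P : Measure Ω)
    (ℱ : Filtration ℕ mΩ) (ν : V → Fin K → Measure ℝ) (π : Policy V K) (T : ℕ)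
    (ctx : ℕ → Ω → V) (arm : ℕ → Ω → Fin K) (rew : ℕ → Ω → ℝ) : Prop where
  ctx_meas : ∀ t < T, ∀ c, MeasurableSet[ℱ t] {ω | ctx t ω = c}
  arm_meas : ∀ t < T, ∀ i, MeasurableSet[ℱ (t + 1)] {ω | arm t ω = i}
  rew_meas : ∀ t < T, Measurable[ℱ (t + 1)] (rew t)
  law : ∀ t < T, ∀ A : Set Ω, MeasurableSet[ℱ t] A → ∀ (i : Fin K) (B : Set ℝ), MeasurableSet B →
    P (A ∩ {ω | arm t ω = i ∧ rew t ω ∈ B}) =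
      ∫⁻ ω in A, ENNReal.ofReal (π (history ctx arm rew t ω) (ctx t ω) i) * ν (ctx t ω) i B ∂P

/-- The pseudo-regret after `T` rounds: the expectation of the sum over the rounds of the best mean
reward in the current context minus the mean reward of the arm played. -/
noncomputable def pseudoRegret {V : Type u} {K : ℕ} {Ω : Type w} [MeasurableSpace Ω] (P : Measure Ω)
    (ν : V → Fin K → Measure ℝ) (T : ℕ) (ctx : ℕ → Ω → V) (arm : ℕ → Ω → Fin K) : ℝ :=
  ∫ ω, ∑ t ∈ Finset.range T, (bestMean ν (ctx t ω) - armMean ν (ctx t ω) (arm t ω)) ∂P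

/-! ## Tsallis-INF with power `1/2` and importance-weighted loss estimators -/

/-- The linear loss plus the Tsallis entropy regularizer of power `1/2` with learning rate `η`. -/
noncomputable def tsallisObjective {K : ℕ} (η : ℝ) (Lhat q : Fin K → ℝ) : ℝ :=
  ∑ i, q i * Lhat i - 4 / η * ∑ i, √(q i)

theorem exists_tsallis_minimizer {K : ℕ} [NeZero K] (η : ℝ) (Lhat : Fin K → ℝ) :
    ∃ q ∈ stdSimplex ℝ (Fin K), IsMinOn (tsallisObjective η Lhat) (stdSimplex ℝ (Fin K)) q := by
  refine (isCompact_stdSimplex ℝ (Fin K)).exists_isMinOn ⟨_, single_mem_stdSimplex ℝ (0 : Fin K)⟩ ?_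
  unfold tsallisObjective
  fun_prop

/-- The (unique, for `η > 0`) minimizer of the regularized cumulative loss estimate over the
probability simplex. -/
noncomputable def tsallisWeights {K : ℕ} [NeZero K] (η : ℝ) (Lhat : Fin K → ℝ) : Fin K → ℝ :=
  (exists_tsallis_minimizer η Lhat).choose

/-- The state of one copy of Tsallis-INF: the number of rounds it has handled, and its cumulative
loss estimates. -/
structure TsallisState (K : ℕ) where
  rounds : ℕ
  est : Fin K → ℝ

namespace TsallisState

/-- The distribution of the next arm; the learning rate in the `t`-th round is `2 / √t`. -/
noncomputable def weights {K : ℕ} [NeZero K] (s : TsallisState K) : Fin K → ℝ :=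
  tsallisWeights (2 / √((s.rounds : ℝ) + 1)) s.est

/-- The update after playing arm `i` and observing the reward `x`, that is, the loss `1 - x`. -/
noncomputable def step {K : ℕ} [NeZero K] (s : TsallisState K) (i : Fin K) (x : ℝ) :
    TsallisState K where
  rounds := s.rounds + 1
  est := fun k => s.est k + if k = i then (1 - x) / s.weights i else 0

end TsallisState

/-! ## The hierarchical algorithm

The contexts sit at positions `0, …, 2 ^ L - 1` of a line. At level `p`, with `1 ≤ p ≤ L`, the line is
cut into `2 ^ p` blocks of `2 ^ (L - p)` consecutive positions, and every block has its own copy of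
Tsallis-INF, which treats all its contexts alike. -/

/-- The states of all copies, indexed by level and block. -/
abbrev HierState (K : ℕ) := ℕ → ℕ → TsallisState K

/-- The index of the block of level `p` that contains the position `x`. -/
def blockIndex (L p x : ℕ) : ℕ := x / 2 ^ (L - p)

/-- The level of the active copy responsible for the position `x`: starting from level `1`, a copy
that has handled `D` rounds is replaced by its children, except at the last level. -/
noncomputable def activeLevel {K : ℕ} (D L : ℕ) (σ : HierState K) (x : ℕ) : ℕ :=
  sInf {p | 1 ≤ p ∧ (L ≤ p ∨ (σ p (blockIndex L p x)).rounds < D)}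

/-- The active copy responsible for the position `x`. -/
noncomputable def activeState {K : ℕ} (D L : ℕ) (σ : HierState K) (x : ℕ) : TsallisState K :=
  σ (activeLevel D L σ x) (blockIndex L (activeLevel D L σ x) x)

/-- Only the active copy responsible for the current context is updated. -/
noncomputable def hierStep {V : Type u} {K : ℕ} [NeZero K] (D L : ℕ) (pos : V → ℕ) (σ : HierState K)
    (r : V × Fin K × ℝ) : HierState K := fun p j =>
  if p = activeLevel D L σ (pos r.1) ∧ j = blockIndex L p (pos r.1) then
    (σ p j).step r.2.1 r.2.2
  else σ p j

/-- The states of all copies after a given past. -/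
noncomputable def hierState {V : Type u} {K : ℕ} [NeZero K] (D L : ℕ) (pos : V → ℕ)
    (h : List (V × Fin K × ℝ)) : HierState K :=
  h.foldl (hierStep D L pos) fun _ _ => ⟨0, fun _ => 0⟩

/-- The hierarchical algorithm with parameter `D` and `L` levels, for contexts `c` placed at
positions `pos c < 2 ^ L` of a line. -/
noncomputable def hierPolicy {V : Type u} {K : ℕ} [NeZero K] (D L : ℕ) (pos : V → ℕ) : Policy V K :=
  fun h c => (activeState D L (hierState D L pos h) (pos c)).weights

/-- The algorithm on the line graph with vertices `0, …, n - 1` in this order, with `⌈log₂ n⌉`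
levels (the line is thought of as extended to a length that is a power of two). -/
noncomputable def linePolicy (n K D : ℕ) [NeZero K] : Policy (Fin n) K :=
  hierPolicy D (Nat.clog 2 n) fun c => (c : ℕ)

/-- A spine of a tree: the sequence of vertices visited by a depth-first traversal, that is, by a
closed walk that crosses every edge exactly twice, with a choice for every vertex of a
position at which it is visited. -/
structure Spine {V : Type u} [DecidableEq V] (G : SimpleGraph V) where
  root : V
  walk : G.Walk root root
  count_edge : ∀ e ∈ G.edgeSet, walk.edges.count e = 2
  pos : V → ℕ
  pos_le : ∀ c, pos c ≤ walk.length
  getVert_pos : ∀ c, walk.getVert (pos c) = c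

/-- The algorithm on a tree: run the algorithm for line graphs on a spine. -/
noncomputable def treePolicy {V : Type u} [DecidableEq V] {G : SimpleGraph V} (S : Spine G)
    (K D : ℕ) [NeZero K] : Policy V K :=
  hierPolicy D (Nat.clog 2 (S.walk.length + 1)) S.pos

/-! One potential function per copy turns the regret into a telescoping sum whose final value is
bounded on every path.

Take a copy of Tsallis-INF whose contexts share their reward distributions and have best arm `k`.
Its potential is the estimated regret of the current weights against `k`, minus a regularizer.
Optimality of the weights keeps it below `2 * K` at all times (`potential_le`). In its `t`-th round
its conditional expected growth is at least the regret of the round minus `11 * S / √t + 4 / t`,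
where `S` is the sum of `√w_i` over `i ≠ k` (`potential_step`, `sum_weights_mul_penalty`). It is
essential that `√w_k` is absent here; `stability_of_half_le` achieves this by charging the movement
of `w_k` to the other arms. Since the regret is at least `δ * ∑_{i ≠ k} w_i`, a second copy of the
regret absorbs the error by AM-GM, at a price of order `K / (δ t)`. So twice the potential plus a
multiple of a harmonic number grows on average at least as fast as the regret
(`sum_weights_mul_gap_le`), and never exceeds order `K log T`. This cap holds pathwise, so the
random, adaptively determined number of rounds of a copy does no harm.

In the hierarchy, a label change lies inside at most one block per level. A block with a change
inside is never at the last level, so its copy handles at most `D` rounds; with `F` changes these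
copies cost at most `F * L * D`. All other blocks are single stochastic bandits. An activated copy
below level `1` has a parent that used up `D` rounds, so at most `2 * T / D + 2` copies are ever
activated (`card_activated_le`). Both contributions are summed in `hierPolicy_pseudoRegret_le`, and
`D` of order `√(TK/f)` balances them. On a tree the spine crosses each edge twice, so `F = 2 * f`,
and its length is linear in the number of vertices. -/

section TsallisWeights

/-! ### Tsallis weights: positivity, optimality, continuity -/

variable {K : ℕ} [NeZero K]

theorem tsallisWeights_mem (η : ℝ) (Lhat : Fin K → ℝ) :
    tsallisWeights η Lhat ∈ stdSimplex ℝ (Fin K) :=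
  (exists_tsallis_minimizer η Lhat).choose_spec.1

theorem tsallisWeights_isMinOn (η : ℝ) (Lhat : Fin K → ℝ) :
    IsMinOn (tsallisObjective η Lhat) (stdSimplex ℝ (Fin K)) (tsallisWeights η Lhat) :=
  (exists_tsallis_minimizer η Lhat).choose_spec.2

theorem tsallisWeights_nonneg (η : ℝ) (Lhat : Fin K → ℝ) (i : Fin K) :
    0 ≤ tsallisWeights η Lhat i :=
  (tsallisWeights_mem η Lhat).1 i

theorem sum_tsallisWeights (η : ℝ) (Lhat : Fin K → ℝ) : ∑ i, tsallisWeights η Lhat i = 1 :=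
  (tsallisWeights_mem η Lhat).2

theorem tsallisWeights_le_one (η : ℝ) (Lhat : Fin K → ℝ) (i : Fin K) :
    tsallisWeights η Lhat i ≤ 1 := by
  rw [← sum_tsallisWeights η Lhat]
  exact Finset.single_le_sum (fun j _ => tsallisWeights_nonneg η Lhat j) (Finset.mem_univ i)

/-- Moving from the minimizer towards `q` does not decrease the objective. -/
theorem tsallisWeights_segment (η : ℝ) (Lhat q : Fin K → ℝ) (hq : q ∈ stdSimplex ℝ (Fin K))
    {l : ℝ} (h0 : 0 ≤ l) (h1 : l ≤ 1) :
    4 / η * ∑ i, (√(tsallisWeights η Lhat i + l * (q i - tsallisWeights η Lhat i)) -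
        √(tsallisWeights η Lhat i)) ≤
      l * ∑ i, (q i - tsallisWeights η Lhat i) * Lhat i := by
  set w := tsallisWeights η Lhat with hw
  have hmem : (fun i => w i + l * (q i - w i)) ∈ stdSimplex ℝ (Fin K) := by
    have := (convex_stdSimplex ℝ (Fin K)) (tsallisWeights_mem η Lhat) hq
      (sub_nonneg.2 h1) h0 (by ring)
    convert this using 1
    ext i
    simp only [Pi.add_apply, Pi.smul_apply, smul_eq_mul, ← hw]
    ring
  have := tsallisWeights_isMinOn η Lhat hmem
  simp only [Set.mem_ofPred_eq, tsallisObjective, ← hw] at this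
  have e : ∑ i, (w i + l * (q i - w i)) * Lhat i =
      ∑ i, w i * Lhat i + l * ∑ i, (q i - w i) * Lhat i := by
    rw [Finset.mul_sum, ← Finset.sum_add_distrib]
    exact Finset.sum_congr rfl fun i _ => by ring
  rw [Finset.sum_sub_distrib, mul_sub]
  linarith

theorem tsallisWeights_pos {η : ℝ} (hη : 0 < η) (Lhat : Fin K → ℝ) (i : Fin K) :
    0 < tsallisWeights η Lhat i := by
  refine (tsallisWeights_nonneg η Lhat i).lt_of_ne' fun hi => ?_
  set w := tsallisWeights η Lhat with hw
  have hw0 : ∀ j, 0 ≤ w j := tsallisWeights_nonneg η Lhat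
  have hw1 : ∀ j, w j ≤ 1 := tsallisWeights_le_one η Lhat
  set q : Fin K → ℝ := Pi.single i 1
  set M := ∑ j, (q j - w j) * Lhat j with hM
  have hη4 : 0 < 4 / η := by positivity
  -- Moving mass `l` to an arm of weight `0` gains `√l` in the entropy there and loses at most `l`
  -- in each coordinate, while the linear part changes by `l * M`.
  have key : ∀ l : ℝ, 0 < l → l ≤ 1 → 4 / η * (√l - K * l) ≤ l * M := by
    intro l h0 h1
    refine le_trans ?_ (tsallisWeights_segment η Lhat q (single_mem_stdSimplex ℝ i) h0.le h1)
    refine mul_le_mul_of_nonneg_left ?_ hη4.le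
    rw [← hw]
    have hterm : ∀ j ∈ Finset.univ, (if j = i then √l else 0) - l ≤
        √(w j + l * (q j - w j)) - √(w j) := by
      intro j _
      by_cases hj : j = i
      · subst hj
        simp [q, hi, h0.le]
      · have hl : (1 - l) * √(w j) ≤ √((1 - l) * w j) := by
          rw [Real.sqrt_mul (by linarith)]
          refine mul_le_mul_of_nonneg_right ?_ (Real.sqrt_nonneg _)
          exact Real.le_sqrt_of_sq_le (by nlinarith)
        have hs : √(w j) ≤ 1 := Real.sqrt_le_one.2 (hw1 j)
        have e : w j + l * (q j - w j) = (1 - l) * w j := by simp [q, hj]; ring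
        rw [e, if_neg hj]
        nlinarith
    refine le_trans (le_of_eq ?_) (Finset.sum_le_sum hterm)
    simp [Finset.sum_sub_distrib]
  have hlim : Filter.Tendsto (fun l : ℝ => l * (M + 4 / η * K)) (nhdsWithin 0 (Set.Ioi 0))
      (nhds 0) := by
    have : Continuous fun l : ℝ => l * (M + 4 / η * K) := by fun_prop
    simpa using (this.tendsto 0).mono_left nhdsWithin_le_nhds
  have hbound : ∀ᶠ l in nhdsWithin (0 : ℝ) (Set.Ioi 0), 4 / η ≤ l * (M + 4 / η * K) := by
    filter_upwards [Ioo_mem_nhdsGT (zero_lt_one' ℝ)] with l hl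
    -- With `l ^ 2` in place of `l`, division by `l` bounds the constant `4 / η` by a quantity
    -- tending to `0`.
    have h := key (l ^ 2) (by have := hl.1; positivity) (by nlinarith [hl.1, hl.2])
    rw [Real.sqrt_sq hl.1.le] at h
    have : l * (4 / η) ≤ l * (l * (M + 4 / η * K)) := by nlinarith
    exact le_of_mul_le_mul_left this hl.1
  exact absurd (ge_of_tendsto hlim hbound) (not_le.2 hη4)

/-- First-order optimality of the weights. -/
theorem tsallisWeights_first_order {η : ℝ} (hη : 0 < η) (Lhat q : Fin K → ℝ)
    (hq : q ∈ stdSimplex ℝ (Fin K)) :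
    4 / η * ∑ i, (q i - tsallisWeights η Lhat i) / (2 * √(tsallisWeights η Lhat i)) ≤
      ∑ i, (q i - tsallisWeights η Lhat i) * Lhat i := by
  set w := tsallisWeights η Lhat with hw
  have hpos : ∀ i, 0 < √(w i) := fun i => Real.sqrt_pos.2 (tsallisWeights_pos hη Lhat i)
  -- These are the difference quotients of the square roots, rationalized so as to be continuous at
  -- `l = 0`.
  have hlim : Filter.Tendsto (fun l : ℝ => 4 / η * ∑ i, (q i - w i) /
      (√(w i + l * (q i - w i)) + √(w i))) (nhdsWithin 0 (Set.Ioi 0))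
      (nhds (4 / η * ∑ i, (q i - w i) / (2 * √(w i)))) := by
    have hc : ContinuousAt (fun l : ℝ => 4 / η * ∑ i, (q i - w i) /
        (√(w i + l * (q i - w i)) + √(w i))) 0 := by
      refine continuousAt_const.mul (tendsto_finsetSum _ fun i _ => ?_)
      refine ContinuousAt.div continuousAt_const (by fun_prop) ?_
      have := hpos i
      simp only [zero_mul, add_zero]
      positivity
    have := hc.tendsto.mono_left (nhdsWithin_le_nhds (s := Set.Ioi 0))
    simpa [two_mul] using this
  refine le_of_tendsto hlim ?_
  filter_upwards [Ioo_mem_nhdsGT (zero_lt_one' ℝ)] with l hl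
  have h := tsallisWeights_segment η Lhat q hq hl.1.le hl.2.le
  rw [← hw] at h
  refine le_of_mul_le_mul_left (le_trans (le_of_eq ?_) h) hl.1
  rw [← mul_assoc, mul_comm l, mul_assoc, Finset.mul_sum]
  congr 1
  refine Finset.sum_congr rfl fun i _ => ?_
  have hnn : 0 ≤ w i + l * (q i - w i) := by
    have h1 := (tsallisWeights_pos hη Lhat i).le
    rw [← hw] at h1
    nlinarith [hq.1 i, hl.1, hl.2]
  have h1 := hpos i
  have h2 := Real.sqrt_nonneg (w i + l * (q i - w i))
  have e1 := Real.sq_sqrt hnn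
  have e2 := Real.sq_sqrt (tsallisWeights_nonneg η Lhat i)
  rw [← hw] at e2
  field_simp
  nlinarith

/-- The objective exceeds its minimum by at least a Bregman divergence. -/
theorem tsallisObjective_ge {η : ℝ} (hη : 0 < η) (Lhat q : Fin K → ℝ)
    (hq : q ∈ stdSimplex ℝ (Fin K)) :
    tsallisObjective η Lhat (tsallisWeights η Lhat) +
        2 / η * ∑ i, (√(q i) - √(tsallisWeights η Lhat i)) ^ 2 / √(tsallisWeights η Lhat i) ≤
      tsallisObjective η Lhat q := by
  have h := tsallisWeights_first_order hη Lhat q hq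
  set w := tsallisWeights η Lhat with hw
  have hpos : ∀ i, 0 < √(w i) := fun i => Real.sqrt_pos.2 (tsallisWeights_pos hη Lhat i)
  -- The Bregman divergence of `-2√` is exactly this quotient, so the first-order condition disposes
  -- of the linear part.
  have e : ∑ i, (√(q i) - √(w i)) ^ 2 / √(w i) =
      2 * ∑ i, (q i - w i) / (2 * √(w i)) - 2 * (∑ i, √(q i) - ∑ i, √(w i)) := by
    rw [← Finset.sum_sub_distrib, Finset.mul_sum, Finset.mul_sum, ← Finset.sum_sub_distrib]
    refine Finset.sum_congr rfl fun i _ => ?_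
    have h1 := hpos i
    have e1 := Real.sq_sqrt (hq.1 i)
    have e2 := Real.sq_sqrt (tsallisWeights_nonneg η Lhat i)
    rw [← hw] at e2
    field_simp
    nlinarith
  have e' : ∑ i, (q i - w i) * Lhat i = ∑ i, q i * Lhat i - ∑ i, w i * Lhat i := by
    rw [← Finset.sum_sub_distrib]
    exact Finset.sum_congr rfl fun i _ => by ring
  simp only [tsallisObjective]
  rw [e]
  have e3 : (4 : ℝ) / η = 2 * (2 / η) := by ring
  rw [e3] at h ⊢
  linarith

/-- The Bregman margins at the two minimizers are added, and the entropies cancel. The resulting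
modulus of continuity serves to make the weights, which are defined by choice, measurable functions
of the estimates. -/
theorem sum_sq_sqrt_tsallisWeights_sub_le {η : ℝ} (hη : 0 < η) (L L' : Fin K → ℝ) :
    ∑ i, (√(tsallisWeights η L i) - √(tsallisWeights η L' i)) ^ 2 ≤ η / 4 * ∑ i, |L i - L' i| := by
  have h1 := tsallisObjective_ge hη L _ (tsallisWeights_mem η L')
  have h2 := tsallisObjective_ge hη L' _ (tsallisWeights_mem η L)
  set w := tsallisWeights η L with hw
  set w' := tsallisWeights η L' with hw'
  have hle : ∀ a b : Fin K → ℝ, (∀ i, 0 < a i) → (∀ i, a i ≤ 1) →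
      ∑ i, (√(b i) - √(a i)) ^ 2 ≤ ∑ i, (√(b i) - √(a i)) ^ 2 / √(a i) := by
    intro a b h0 h1
    refine Finset.sum_le_sum fun i _ => ?_
    exact le_div_self (sq_nonneg _) (Real.sqrt_pos.2 (h0 i)) (Real.sqrt_le_one.2 (h1 i))
  have h3 := hle w w' (tsallisWeights_pos hη L) (tsallisWeights_le_one η L)
  have h4 := hle w' w (tsallisWeights_pos hη L') (tsallisWeights_le_one η L')
  have h5 : ∑ i, (√(w' i) - √(w i)) ^ 2 = ∑ i, (√(w i) - √(w' i)) ^ 2 :=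
    Finset.sum_congr rfl fun i _ => by ring
  have h6 : (∑ i, w' i * L i - ∑ i, w i * L i) + (∑ i, w i * L' i - ∑ i, w' i * L' i) ≤
      ∑ i, |L i - L' i| := by
    rw [← Finset.sum_sub_distrib, ← Finset.sum_sub_distrib, ← Finset.sum_add_distrib]
    refine Finset.sum_le_sum fun i _ => ?_
    have e : w' i * L i - w i * L i + (w i * L' i - w' i * L' i) = (w' i - w i) * (L i - L' i) := by
      ring
    rw [e]
    refine (le_abs_self _).trans ?_
    rw [abs_mul]
    refine mul_le_of_le_one_left (abs_nonneg _) ?_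
    rw [abs_le]
    have a1 := tsallisWeights_le_one η L i
    have a2 := tsallisWeights_le_one η L' i
    have a3 := tsallisWeights_nonneg η L i
    have a4 := tsallisWeights_nonneg η L' i
    constructor <;> linarith
  simp only [tsallisObjective] at h1 h2
  have hη2 : 0 < 2 / η := by positivity
  have h7 : 2 / η * (2 * ∑ i, (√(w i) - √(w' i)) ^ 2) ≤ ∑ i, |L i - L' i| := by
    have := mul_le_mul_of_nonneg_left h3 hη2.le
    have := mul_le_mul_of_nonneg_left h4 hη2.le
    rw [h5] at *
    linarith
  have h8 : ∑ i, (√(w i) - √(w' i)) ^ 2 =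
      η / 4 * (2 / η * (2 * ∑ i, (√(w i) - √(w' i)) ^ 2)) := by
    field_simp
    ring
  rw [h8]
  exact mul_le_mul_of_nonneg_left h7 (by positivity)

theorem continuous_tsallisWeights {η : ℝ} (hη : 0 < η) :
    Continuous (tsallisWeights η : (Fin K → ℝ) → Fin K → ℝ) := by
  refine continuous_pi fun i => ?_
  have hs : Continuous fun L : Fin K → ℝ => √(tsallisWeights η L i) := by
    rw [continuous_iff_continuousAt]
    intro L
    have hb : ∀ L', |√(tsallisWeights η L' i) - √(tsallisWeights η L i)| ≤
        √(η / 4 * ∑ i, |L' i - L i|) := by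
      intro L'
      refine Real.le_sqrt_of_sq_le ?_
      rw [sq_abs]
      refine le_trans ?_ (sum_sq_sqrt_tsallisWeights_sub_le hη L' L)
      exact Finset.single_le_sum
        (f := fun i => (√(tsallisWeights η L' i) - √(tsallisWeights η L i)) ^ 2)
        (fun j _ => sq_nonneg _) (Finset.mem_univ i)
    have hc : Continuous fun L' : Fin K → ℝ => √(η / 4 * ∑ i, |L' i - L i|) := by fun_prop
    have ht := hc.tendsto L
    simp only [sub_self, abs_zero, Finset.sum_const_zero, mul_zero, Real.sqrt_zero] at ht
    rw [ContinuousAt, tendsto_iff_dist_tendsto_zero]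
    exact squeeze_zero (fun _ => dist_nonneg) (fun L' => by rw [Real.dist_eq]; exact hb L') ht
  have e : (fun L : Fin K → ℝ => tsallisWeights η L i) = fun L => √(tsallisWeights η L i) ^ 2 := by
    ext L
    exact (Real.sq_sqrt (tsallisWeights_nonneg η L i)).symm
  rw [e]
  exact hs.pow 2

end TsallisWeights

/-! ### Regret analysis of a single copy of Tsallis-INF -/

namespace TsallisState

variable {K : ℕ}

/-- The inverse learning-rate scale of the next round. -/
noncomputable def rate (s : TsallisState K) : ℝ := √((s.rounds : ℝ) + 1)

theorem one_le_rate (s : TsallisState K) : 1 ≤ s.rate := by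
  rw [rate, Real.one_le_sqrt]
  linarith [Nat.cast_nonneg (α := ℝ) s.rounds]

theorem rate_pos (s : TsallisState K) : 0 < s.rate := zero_lt_one.trans_le s.one_le_rate

theorem rate_sq (s : TsallisState K) : s.rate ^ 2 = s.rounds + 1 :=
  Real.sq_sqrt (by positivity)

theorem sqrt_rounds_le_rate (s : TsallisState K) : √(s.rounds : ℝ) ≤ s.rate :=
  Real.sqrt_le_sqrt (by linarith)

theorem rate_sub_le (s : TsallisState K) : s.rate - √(s.rounds : ℝ) ≤ 1 / s.rate := by
  have h := s.rate_pos
  rw [le_div_iff₀ h]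
  have h1 := s.rate_sq
  have h2 := Real.sq_sqrt (Nat.cast_nonneg (α := ℝ) s.rounds)
  have h3 := s.sqrt_rounds_le_rate
  nlinarith [Real.sqrt_nonneg (s.rounds : ℝ)]

variable [NeZero K]

theorem weights_pos (s : TsallisState K) (i : Fin K) : 0 < s.weights i :=
  tsallisWeights_pos (by have := s.rate_pos; rw [rate] at this; positivity) _ _

theorem weights_le_one (s : TsallisState K) (i : Fin K) : s.weights i ≤ 1 :=
  tsallisWeights_le_one _ _ _

theorem sum_weights (s : TsallisState K) : ∑ i, s.weights i = 1 := sum_tsallisWeights _ _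

theorem weights_mem (s : TsallisState K) : s.weights ∈ stdSimplex ℝ (Fin K) :=
  tsallisWeights_mem _ _

/-- The objective minimized by the weights, with the Bregman divergence as a margin. -/
theorem weights_objective_le (s : TsallisState K) (q : Fin K → ℝ) (hq : q ∈ stdSimplex ℝ (Fin K)) :
    ∑ i, s.weights i * s.est i - 2 * s.rate * ∑ i, √(s.weights i) +
        s.rate * ∑ i, (√(q i) - √(s.weights i)) ^ 2 / √(s.weights i) ≤
      ∑ i, q i * s.est i - 2 * s.rate * ∑ i, √(q i) := by
  have hR := s.rate_pos
  have h := tsallisObjective_ge (η := 2 / √((s.rounds : ℝ) + 1))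
    (by rw [rate] at hR; positivity) s.est q hq
  simp only [tsallisObjective] at h
  have e1 : 4 / (2 / √((s.rounds : ℝ) + 1)) = 2 * s.rate := by
    rw [rate] at *; field_simp; norm_num
  have e2 : 2 / (2 / √((s.rounds : ℝ) + 1)) = s.rate := by
    rw [rate] at *; field_simp
  rw [e1, e2] at h
  exact h

/-- The sum of the square roots of the weights of the arms other than `k`. -/
noncomputable def sqrtMass (s : TsallisState K) (k : Fin K) : ℝ :=
  ∑ i ∈ Finset.univ.erase k, √(s.weights i)

theorem sqrtMass_nonneg (s : TsallisState K) (k : Fin K) : 0 ≤ s.sqrtMass k :=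
  Finset.sum_nonneg fun _ _ => Real.sqrt_nonneg _

theorem sum_sqrt_weights (s : TsallisState K) (k : Fin K) :
    ∑ i, √(s.weights i) = √(s.weights k) + s.sqrtMass k :=
  (Finset.add_sum_erase _ _ (Finset.mem_univ k)).symm

theorem one_sub_weights_le_sqrtMass (s : TsallisState K) (k : Fin K) :
    1 - s.weights k ≤ s.sqrtMass k := by
  rw [← s.sum_weights, ← Finset.add_sum_erase _ _ (Finset.mem_univ k), add_sub_cancel_left]
  refine Finset.sum_le_sum fun i _ => ?_
  exact Real.le_sqrt_of_sq_le (by nlinarith [s.weights_pos i, s.weights_le_one i])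

theorem sum_sqrt_weights_le (s : TsallisState K) : ∑ i, √(s.weights i) ≤ K := by
  refine (Finset.sum_le_sum fun i _ => Real.sqrt_le_one.2 (s.weights_le_one i)).trans ?_
  simp

/-- The regularized regret of a copy with respect to the arm `k`, up to a telescoping change of the
learning rate. -/
noncomputable def potential (s : TsallisState K) (k : Fin K) : ℝ :=
  -- The weights are optimal for `√(rounds + 1)`, yet `√rounds` appears. After a step it becomes the
  -- rate for which the old weights were optimal, so old and new weights can be compared at one
  -- rate.
  ∑ i, s.weights i * s.est i - s.est k - 2 * √(s.rounds : ℝ) * (∑ i, √(s.weights i) - 1)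

theorem potential_le (s : TsallisState K) (k : Fin K) : s.potential k ≤ 2 * K := by
  have h := s.weights_objective_le _ (single_mem_stdSimplex ℝ k)
  have hb : 0 ≤ s.rate * ∑ i, (√((Pi.single k 1 : Fin K → ℝ) i) - √(s.weights i)) ^ 2 /
      √(s.weights i) :=
    mul_nonneg s.rate_pos.le (Finset.sum_nonneg fun i _ => by positivity)
  have e1 : ∑ i, (Pi.single k 1 : Fin K → ℝ) i * s.est i = s.est k := by
    simp [Pi.single_apply]
  have e2 : ∑ i, √((Pi.single k 1 : Fin K → ℝ) i) = 1 := by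
    rw [Finset.sum_eq_single k] <;> simp +contextual
  rw [e1, e2] at h
  have h1 := s.sqrt_rounds_le_rate
  have h2 := s.rate_sub_le
  have h3 := s.sum_sqrt_weights_le
  have h4 : 1 / s.rate ≤ 1 := by
    rw [div_le_one s.rate_pos]; exact s.one_le_rate
  have h5 : 0 ≤ ∑ i, √(s.weights i) := Finset.sum_nonneg fun _ _ => Real.sqrt_nonneg _
  have h6 : (s.rate - √(s.rounds : ℝ)) * ∑ i, √(s.weights i) ≤ ∑ i, √(s.weights i) :=
    mul_le_of_le_one_left h5 (h2.trans h4)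
  simp only [potential]
  nlinarith

/-- The stability penalty of playing the arm `i` when `k` is the best arm. -/
noncomputable def penalty (s : TsallisState K) (k i : Fin K) : ℝ :=
  (if i = k then 8 * s.sqrtMass k / s.rate + 4 / s.rate ^ 2 else √(s.weights i) / s.rate) /
    s.weights i

theorem sum_weights_mul_penalty (s : TsallisState K) (k : Fin K) :
    ∑ i, s.weights i * s.penalty k i = 9 * s.sqrtMass k / s.rate + 4 / s.rate ^ 2 := by
  have e : ∀ i, s.weights i * s.penalty k i =
      if i = k then 8 * s.sqrtMass k / s.rate + 4 / s.rate ^ 2 else √(s.weights i) / s.rate :=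
    fun i => mul_div_cancel₀ _ (s.weights_pos i).ne'
  simp only [e]
  rw [← Finset.add_sum_erase _ _ (Finset.mem_univ k), if_pos rfl]
  have : ∑ i ∈ Finset.univ.erase k, (if i = k then 8 * s.sqrtMass k / s.rate + 4 / s.rate ^ 2
      else √(s.weights i) / s.rate) = s.sqrtMass k / s.rate := by
    rw [sqrtMass, Finset.sum_div]
    exact Finset.sum_congr rfl fun i hi => if_neg (Finset.ne_of_mem_erase hi)
  rw [this]
  ring

/-- The general stability bound for playing the arm `i` with loss `l`. -/
theorem stability (s : TsallisState K) (q : Fin K → ℝ) (hq : q ∈ stdSimplex ℝ (Fin K))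
    (i : Fin K) {l : ℝ} (h0 : 0 ≤ l) (h1 : l ≤ 1) :
    l - √(s.weights i) / s.rate / s.weights i ≤
      q i * (l / s.weights i) +
        s.rate * ∑ j, (√(q j) - √(s.weights j)) ^ 2 / √(s.weights j) := by
  have hR := s.rate_pos
  have hw := s.weights_pos i
  have hsum : (√(q i) - √(s.weights i)) ^ 2 / √(s.weights i) ≤
      ∑ j, (√(q j) - √(s.weights j)) ^ 2 / √(s.weights j) :=
    Finset.single_le_sum (f := fun j => (√(q j) - √(s.weights j)) ^ 2 / √(s.weights j))
      (fun j _ => by positivity) (Finset.mem_univ i)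
  refine le_trans ?_ (add_le_add_right (mul_le_mul_of_nonneg_left hsum hR.le) _)
  have e1 := Real.sq_sqrt hw.le
  have e2 := Real.sq_sqrt (hq.1 i)
  have hs := Real.sqrt_pos.2 hw
  have hu := Real.sqrt_nonneg (q i)
  generalize √(s.weights i) = t at *
  generalize √(q i) = r at *
  generalize s.rate = R at *
  rw [← e1, ← e2]
  have : r ^ 2 * (l / t ^ 2) + R * ((r - t) ^ 2 / t) - (l - t / R / t ^ 2) =
      (l * R * (r - t) ^ 2 + t * (R * (r - t) + l) ^ 2 + t * (1 - l ^ 2)) / (R * t ^ 2) := by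
    field_simp
    ring
  have : 0 ≤ r ^ 2 * (l / t ^ 2) + R * ((r - t) ^ 2 / t) - (l - t / R / t ^ 2) := by
    rw [this]
    have : 0 ≤ 1 - l ^ 2 := by nlinarith
    positivity
  linarith

/-- The stability bound for playing an arm of large weight. -/
theorem stability_of_half_le (s : TsallisState K) (q : Fin K → ℝ) (hq : q ∈ stdSimplex ℝ (Fin K))
    (k : Fin K) {l : ℝ} (h0 : 0 ≤ l) (h1 : l ≤ 1) (hw : 1 / 2 ≤ s.weights k) (hR : 4 ≤ s.rate) :
    l - 8 * s.sqrtMass k / s.rate ≤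
      q k * (l / s.weights k) +
        s.rate * ∑ j, (√(q j) - √(s.weights j)) ^ 2 / √(s.weights j) := by
  have hRp := s.rate_pos
  have hwp := s.weights_pos k
  set x := l / s.weights k with hx
  have hx0 : 0 ≤ x := by positivity
  have hx2 : x ≤ 2 := by rw [hx, div_le_iff₀ hwp]; linarith
  have hl : l = x * s.weights k := by rw [hx]; field_simp
  -- Conservation of mass charges the movement of the heavy arm `k` to the other arms, which
  -- replaces an error of order `1 / s.rate` by one of order `s.sqrtMass k / s.rate`.
  have eq : q k - s.weights k = - ∑ j ∈ Finset.univ.erase k, (q j - s.weights j) := by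
    rw [Finset.sum_sub_distrib]
    have a1 := Finset.add_sum_erase _ q (Finset.mem_univ k)
    have a2 := Finset.add_sum_erase _ s.weights (Finset.mem_univ k)
    rw [hq.2] at a1
    rw [s.sum_weights] at a2
    linarith
  have hterm : ∀ j, x * (q j - s.weights j) ≤
      s.rate * ((√(q j) - √(s.weights j)) ^ 2 / √(s.weights j)) +
        8 * √(s.weights j) / s.rate := by
    intro j
    have hwj := s.weights_pos j
    have hs := Real.sqrt_pos.2 hwj
    have hs1 := Real.sqrt_le_one.2 (s.weights_le_one j)
    have e1 := Real.sq_sqrt hwj.le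
    have e2 := Real.sq_sqrt (hq.1 j)
    generalize √(s.weights j) = t at *
    generalize √(q j) = r at *
    generalize s.rate = R at *
    rw [← e1, ← e2]
    obtain ⟨d, rfl⟩ : ∃ d, r = t + d := ⟨r - t, by ring⟩
    have b1 : x * ((t + d) ^ 2 - t ^ 2) ≤ 4 * t * |d| + 2 * d ^ 2 := by
      have : x * ((t + d) ^ 2 - t ^ 2) = x * (2 * t * d) + x * d ^ 2 := by ring
      have c1 : x * (2 * t * d) ≤ x * (2 * t * |d|) :=
        mul_le_mul_of_nonneg_left (by nlinarith [le_abs_self d]) hx0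
      have c2 : x * (2 * t * |d|) ≤ 2 * (2 * t * |d|) :=
        mul_le_mul_of_nonneg_right hx2 (by positivity)
      nlinarith [sq_nonneg d]
    -- Half of the Bregman term absorbs the linear part in `d`, the other half the quadratic part;
    -- the latter is where `4 ≤ R` and `t ≤ 1` enter.
    have b2 : 4 * t * |d| + 2 * d ^ 2 ≤ R * (d ^ 2 / t) + 8 * t / R := by
      rw [← sq_abs d]
      generalize |d| = d
      have : R * (d ^ 2 / t) + 8 * t / R - (4 * t * d + 2 * d ^ 2) =
          ((R * d - 4 * t ^ 2) ^ 2 / 2 + d ^ 2 * R * (R - 4 * t) / 2 + 8 * t ^ 2 * (1 - t ^ 2)) /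
            (R * t) := by
        field_simp
        ring
      have h2 : 0 ≤ R * (d ^ 2 / t) + 8 * t / R - (4 * t * d + 2 * d ^ 2) := by
        rw [this]
        have c1 : 0 ≤ R - 4 * t := by linarith
        have c2 : 0 ≤ 1 - t ^ 2 := by nlinarith
        positivity
      linarith
    have : t + d - t = d := by ring
    rw [this]
    exact b1.trans b2
  have hsum := Finset.sum_le_sum fun j (_ : j ∈ Finset.univ.erase k) => hterm j
  rw [← Finset.mul_sum, Finset.sum_add_distrib, ← Finset.mul_sum, ← Finset.sum_div,
    ← Finset.mul_sum] at hsum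
  have hmono : ∑ j ∈ Finset.univ.erase k, (√(q j) - √(s.weights j)) ^ 2 / √(s.weights j) ≤
      ∑ j, (√(q j) - √(s.weights j)) ^ 2 / √(s.weights j) :=
    Finset.sum_le_sum_of_subset_of_nonneg (Finset.erase_subset _ _) fun j _ _ => by positivity
  have := mul_le_mul_of_nonneg_left hmono hRp.le
  have e3 : x * q k = x * s.weights k + x * (q k - s.weights k) := by ring
  rw [eq] at e3
  rw [mul_comm (q k), hl, e3, sqrtMass]
  linarith

/-- For `i = k` the generic error `1 / s.rate` must be avoided. If the weight of `k` is below `1 /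
2`, then `s.sqrtMass k` exceeds `1 / 2` and dominates it; if `s.rate < 4`, the summable term `4 /
s.rate ^ 2` does; otherwise `stability_of_half_le` applies. -/
theorem stability_penalty (s : TsallisState K) (q : Fin K → ℝ) (hq : q ∈ stdSimplex ℝ (Fin K))
    (k i : Fin K) {l : ℝ} (h0 : 0 ≤ l) (h1 : l ≤ 1) :
    l - s.penalty k i ≤
      q i * (l / s.weights i) +
        s.rate * ∑ j, (√(q j) - √(s.weights j)) ^ 2 / √(s.weights j) := by
  have hR := s.rate_pos
  have hw := s.weights_pos i
  have hS := s.sqrtMass_nonneg k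
  by_cases hik : i = k
  · subst hik
    by_cases hc : 1 / 2 ≤ s.weights i ∧ 4 ≤ s.rate
    · refine le_trans (sub_le_sub_left ?_ _) (s.stability_of_half_le q hq i h0 h1 hc.1 hc.2)
      rw [penalty, if_pos rfl, le_div_iff₀ hw]
      have : 8 * s.sqrtMass i / s.rate * s.weights i ≤ 8 * s.sqrtMass i / s.rate :=
        mul_le_of_le_one_right (by positivity) (s.weights_le_one i)
      have : 0 ≤ 4 / s.rate ^ 2 := by positivity
      linarith
    · refine le_trans (sub_le_sub_left ?_ _) (s.stability q hq i h0 h1)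
      rw [penalty, if_pos rfl]
      refine div_le_div_of_nonneg_right ?_ hw.le
      have hs : √(s.weights i) / s.rate ≤ 1 / s.rate :=
        div_le_div_of_nonneg_right (Real.sqrt_le_one.2 (s.weights_le_one i)) hR.le
      refine hs.trans ?_
      rcases not_and_or.1 hc with hc | hc
      · have := s.one_sub_weights_le_sqrtMass i
        have : 1 / s.rate ≤ 8 * s.sqrtMass i / s.rate :=
          div_le_div_of_nonneg_right (by linarith) hR.le
        have : 0 ≤ 4 / s.rate ^ 2 := by positivity
        linarith
      · have : 1 / s.rate ≤ 4 / s.rate ^ 2 := by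
          rw [div_le_div_iff₀ hR (by positivity)]
          nlinarith
        have : 0 ≤ 8 * s.sqrtMass i / s.rate := by positivity
        linarith
  · rw [penalty, if_neg hik]
    exact s.stability q hq i h0 h1

/-- The growth of the potential in one round. -/
theorem potential_step (s : TsallisState K) (k i : Fin K) {x : ℝ} (h0 : 0 ≤ x) (h1 : x ≤ 1) :
    (1 - x) - (if i = k then (1 - x) / s.weights k else 0) - s.penalty k i -
        2 * s.sqrtMass k / s.rate ≤
      (s.step i x).potential k - s.potential k := by
  have hq := (s.step i x).weights_mem
  have hobj := s.weights_objective_le _ hq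
  have hstab := s.stability_penalty _ hq k i (l := 1 - x) (by linarith) (by linarith)
  have hr : (((s.step i x).rounds : ℕ) : ℝ) = s.rounds + 1 := by simp [step]
  simp only [potential, hr]
  rw [show √((s.rounds : ℝ) + 1) = s.rate from rfl]
  generalize (s.step i x).weights = q at *
  have he : ∑ j, q j * (s.step i x).est j =
      ∑ j, q j * s.est j + q i * ((1 - x) / s.weights i) := by
    simp only [step, mul_add, Finset.sum_add_distrib]
    simp
  have hk : (s.step i x).est k = s.est k + if i = k then (1 - x) / s.weights k else 0 := by
    by_cases hik : i = k
    · subst hik; simp [step]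
    · simp [step, hik, Ne.symm hik]
  rw [he, hk, s.sum_sqrt_weights k] at *
  have hd : 2 * (s.rate - √(s.rounds : ℝ)) * (√(s.weights k) + s.sqrtMass k - 1) ≤
      2 * s.sqrtMass k / s.rate := by
    have a1 : √(s.weights k) + s.sqrtMass k - 1 ≤ s.sqrtMass k := by
      linarith [Real.sqrt_le_one.2 (s.weights_le_one k)]
    have a2 := s.sqrt_rounds_le_rate
    calc _ ≤ 2 * (s.rate - √(s.rounds : ℝ)) * s.sqrtMass k :=
          mul_le_mul_of_nonneg_left a1 (by linarith)
      _ ≤ 2 * (1 / s.rate) * s.sqrtMass k :=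
          mul_le_mul_of_nonneg_right (by linarith [s.rate_sub_le]) (s.sqrtMass_nonneg k)
      _ = _ := by ring
  linarith

/-- The potential of a copy whose best arm is `k`, including the logarithmic term. -/
noncomputable def regretPotential (A : ℝ) (k : Fin K) (s : TsallisState K) : ℝ :=
  2 * s.potential k + A * harmonic s.rounds

/-- A lower bound on the growth of `regretPotential` when the arm `i` is played and the reward
`x` is observed is `growthConst + growthSlope * x`. -/
noncomputable def growthConst (A : ℝ) (k : Fin K) (s : TsallisState K) (i : Fin K) : ℝ :=
  2 * (1 - (if i = k then 1 / s.weights k else 0) - s.penalty k i -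
    2 * s.sqrtMass k / s.rate) + A / s.rate ^ 2

/-- The bound is kept affine in the reward so that averaging over the reward replaces it by its
mean. The factor `2` provides the spare copy of the regret. -/
noncomputable def growthSlope (k : Fin K) (s : TsallisState K) (i : Fin K) : ℝ :=
  2 * ((if i = k then 1 / s.weights k else 0) - 1)

theorem growth_le (A : ℝ) (s : TsallisState K) (k i : Fin K) {x : ℝ} (h0 : 0 ≤ x) (h1 : x ≤ 1) :
    s.growthConst A k i + s.growthSlope k i * x ≤
      (s.step i x).regretPotential A k - s.regretPotential A k := by
  have h := s.potential_step k i h0 h1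
  have hh : ((harmonic (s.step i x).rounds : ℚ) : ℝ) = harmonic s.rounds + 1 / s.rate ^ 2 := by
    simp [step, harmonic_succ, s.rate_sq]
  rw [regretPotential, regretPotential, hh, growthConst, growthSlope]
  have e : (if i = k then (1 - x) / s.weights k else 0) =
      (1 - x) * (if i = k then 1 / s.weights k else 0) := by
    split_ifs <;> ring
  rw [e] at h
  have e2 : A / s.rate ^ 2 = A * (1 / s.rate ^ 2) := by ring
  rw [e2]
  nlinarith

/-- The expected growth of the potential pays for the expected regret of the round. -/
theorem sum_weights_mul_gap_le (s : TsallisState K) (k : Fin K) {δ A m : ℝ} {μ : Fin K → ℝ}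
    (hδ : 0 < δ) (hA : 121 * K / δ + 8 ≤ A) (hm : μ k = m) (hgap : ∀ i, i ≠ k → δ ≤ m - μ i) :
    ∑ i, s.weights i * (m - μ i) ≤
      ∑ i, s.weights i * (s.growthConst A k i + s.growthSlope k i * μ i) := by
  have hR := s.rate_pos
  -- The `22` is twice the sum of `9` from the penalty and `2` from the change of rate; the `8` is
  -- twice the `4` of the penalty.
  have e : ∑ i, s.weights i * (s.growthConst A k i + s.growthSlope k i * μ i) =
      2 * ∑ i, s.weights i * (m - μ i) - 22 * s.sqrtMass k / s.rate + (A - 8) / s.rate ^ 2 := by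
    have e1 : ∀ i, s.weights i * (s.growthConst A k i + s.growthSlope k i * μ i) =
        2 * (s.weights i * (m - μ i)) +
        s.weights i * (2 * (1 - m) - 4 * s.sqrtMass k / s.rate + A / s.rate ^ 2)
        - 2 * (s.weights i * s.penalty k i) - (if i = k then 2 * (1 - m) else 0) := by
      intro i
      rw [growthConst, growthSlope]
      by_cases hik : i = k
      · subst hik
        have := s.weights_pos i
        simp only [if_true, hm]
        field_simp
        ring
      · simp only [hik, if_false]
        ring
    simp only [e1]
    rw [Finset.sum_sub_distrib, Finset.sum_sub_distrib, Finset.sum_add_distrib, ← Finset.sum_mul,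
      s.sum_weights, ← Finset.mul_sum, ← Finset.mul_sum, s.sum_weights_mul_penalty,
      Finset.sum_ite_eq']
    simp only [Finset.mem_univ, if_true]
    ring
  rw [e]
  have hg : ∑ i ∈ Finset.univ.erase k, δ * s.weights i ≤ ∑ i, s.weights i * (m - μ i) := by
    rw [← Finset.add_sum_erase _ _ (Finset.mem_univ k), hm]
    have : ∑ i ∈ Finset.univ.erase k, δ * s.weights i ≤
        ∑ i ∈ Finset.univ.erase k, s.weights i * (m - μ i) := by
      refine Finset.sum_le_sum fun i hi => ?_
      rw [mul_comm]
      exact mul_le_mul_of_nonneg_left (hgap i (Finset.ne_of_mem_erase hi)) (s.weights_pos i).le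
    linarith
  -- AM-GM arm by arm, with `121 = (22 / 2) ^ 2`; this self-bounding step yields a logarithm instead
  -- of a square root.
  have hterm : 22 * s.sqrtMass k / s.rate ≤
      ∑ i ∈ Finset.univ.erase k, δ * s.weights i + 121 * K / δ / s.rate ^ 2 := by
    have h1 : ∀ i, 22 * √(s.weights i) / s.rate ≤ δ * s.weights i + 121 / δ / s.rate ^ 2 := by
      intro i
      have e1 := Real.sq_sqrt (s.weights_pos i).le
      generalize √(s.weights i) = t at *
      rw [← e1]
      have : δ * t ^ 2 + 121 / δ / s.rate ^ 2 - 22 * t / s.rate =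
          (δ * t * s.rate - 11) ^ 2 / (δ * s.rate ^ 2) := by
        field_simp
        ring
      have : 0 ≤ δ * t ^ 2 + 121 / δ / s.rate ^ 2 - 22 * t / s.rate := by
        rw [this]; positivity
      linarith
    have h2 := Finset.sum_le_sum fun i (_ : i ∈ Finset.univ.erase k) => h1 i
    rw [← Finset.sum_div, ← Finset.mul_sum, Finset.sum_add_distrib, Finset.sum_const,
      nsmul_eq_mul] at h2
    have h3 : ((Finset.univ.erase k).card : ℝ) ≤ K := by
      have := Finset.card_le_univ (Finset.univ.erase k)
      rw [Fintype.card_fin] at this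
      exact_mod_cast this
    have h4 : ((Finset.univ.erase k).card : ℝ) * (121 / δ / s.rate ^ 2) ≤
        121 * K / δ / s.rate ^ 2 := by
      refine (mul_le_mul_of_nonneg_right h3 (by positivity)).trans (le_of_eq (by ring))
    rw [sqrtMass]
    linarith
  have hAdiv : 121 * K / δ / s.rate ^ 2 ≤ (A - 8) / s.rate ^ 2 :=
    div_le_div_of_nonneg_right (by linarith) (by positivity)
  linarith

theorem weights_mul_penalty_mem (s : TsallisState K) (k i : Fin K) :
    0 ≤ s.weights i * s.penalty k i ∧ s.weights i * s.penalty k i ≤ 9 * K + 4 := by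
  have hR := s.rate_pos
  have hS := s.sqrtMass_nonneg k
  have hnn : ∀ j, 0 ≤ s.weights j * s.penalty k j := by
    intro j
    have := s.weights_pos j
    refine mul_nonneg this.le ?_
    unfold penalty
    split_ifs <;> positivity
  refine ⟨hnn i, (Finset.single_le_sum (f := fun j => s.weights j * s.penalty k j)
    (fun j _ => hnn j) (Finset.mem_univ i)).trans ?_⟩
  rw [s.sum_weights_mul_penalty]
  have h1 := s.one_le_rate
  have h2 : s.sqrtMass k ≤ K := by
    have := s.sum_sqrt_weights_le
    rw [s.sum_sqrt_weights k] at this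
    linarith [Real.sqrt_nonneg (s.weights k)]
  have h3 : 9 * s.sqrtMass k / s.rate ≤ 9 * s.sqrtMass k := div_le_self (by positivity) h1
  have h4 : 4 / s.rate ^ 2 ≤ 4 := div_le_self (by norm_num) (one_le_pow₀ h1)
  linarith

end TsallisState

/-! ### The tree of copies: invariants, activation count, total potential -/

section Hierarchy

variable {V : Type u} {K : ℕ}

theorem activeLevel_spec (D : ℕ) {L : ℕ} (hL : 1 ≤ L) (σ : HierState K) (x : ℕ) :
    1 ≤ activeLevel D L σ x ∧ (L ≤ activeLevel D L σ x ∨ (activeState D L σ x).rounds < D) :=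
  Nat.sInf_mem (s := {p | 1 ≤ p ∧ (L ≤ p ∨ (σ p (blockIndex L p x)).rounds < D)})
    ⟨L, hL, Or.inl le_rfl⟩

theorem activeLevel_le (D : ℕ) {L : ℕ} (hL : 1 ≤ L) (σ : HierState K) (x : ℕ) :
    activeLevel D L σ x ≤ L :=
  Nat.sInf_le ⟨hL, Or.inl le_rfl⟩

theorem le_rounds_of_lt_activeLevel {D L : ℕ} {σ : HierState K} {x q : ℕ} (hq : 1 ≤ q)
    (h : q < activeLevel D L σ x) : D ≤ (σ q (blockIndex L q x)).rounds := by
  have := Nat.notMem_of_lt_sInf h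
  simp only [Set.mem_ofPred_eq, not_and_or, not_or, not_lt] at this
  tauto

theorem blockIndex_div_two {L p : ℕ} (h1 : 1 ≤ p) (hp : p ≤ L) (x : ℕ) :
    blockIndex L p x / 2 = blockIndex L (p - 1) x := by
  rw [blockIndex, blockIndex, Nat.div_div_eq_div_mul, ← pow_succ]
  congr 2
  omega

theorem blockIndex_lt {L p x : ℕ} (hp : p ≤ L) (hx : x < 2 ^ L) : blockIndex L p x < 2 ^ p := by
  rw [blockIndex, Nat.div_lt_iff_lt_mul (by positivity), ← pow_add]
  convert hx using 2
  omega

variable [NeZero K] {D L : ℕ} {pos : V → ℕ}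

/-- Invariants of the states that the hierarchical algorithm can reach. -/
structure HierInvariant (D L : ℕ) (σ : HierState K) : Prop where
  eq_init : ∀ p j, (σ p j).rounds = 0 → σ p j = ⟨0, fun _ => 0⟩
  mem : ∀ p j, 0 < (σ p j).rounds → 1 ≤ p ∧ p ≤ L ∧ j < 2 ^ p
  rounds_le : ∀ p j, p < L → (σ p j).rounds ≤ D
  parent : ∀ p j, 2 ≤ p → 0 < (σ p j).rounds → D ≤ (σ (p - 1) (j / 2)).rounds

theorem rounds_le_rounds_hierStep (σ : HierState K) (r : V × Fin K × ℝ) (p j : ℕ) :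
    (σ p j).rounds ≤ (hierStep D L pos σ r p j).rounds := by
  unfold hierStep
  split_ifs <;> simp [TsallisState.step]

theorem hierInvariant_hierStep (hL : 1 ≤ L) (hpos : ∀ c, pos c < 2 ^ L) {σ : HierState K}
    (hσ : HierInvariant D L σ) (r : V × Fin K × ℝ) :
    HierInvariant D L (hierStep D L pos σ r) := by
  have h1 := activeLevel_spec D hL σ (pos r.1)
  have h2 := activeLevel_le D hL σ (pos r.1)
  refine ⟨fun p j => ?_, fun p j => ?_, fun p j hp => ?_, fun p j hp hpos' => ?_⟩
  · unfold hierStep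
    split_ifs with h
    · simp [TsallisState.step]
    · exact hσ.eq_init p j
  · unfold hierStep
    split_ifs with h
    · intro _
      refine ⟨h.1 ▸ h1.1, h.1 ▸ h2, ?_⟩
      rw [h.2]
      exact blockIndex_lt (h.1 ▸ h2) (hpos _)
    · exact hσ.mem p j
  · unfold hierStep
    split_ifs with h
    · have h3 := h1.2
      rw [activeState, ← h.1, ← h.2] at h3
      simp only [TsallisState.step]
      omega
    · exact hσ.rounds_le p j hp
  · refine le_trans ?_ (rounds_le_rounds_hierStep σ r _ _)
    by_cases h : p = activeLevel D L σ (pos r.1) ∧ j = blockIndex L p (pos r.1)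
    · rw [h.2, blockIndex_div_two (by omega) (h.1 ▸ h2)]
      exact le_rounds_of_lt_activeLevel (by omega) (by omega)
    · simp only [hierStep, if_neg h] at hpos'
      exact hσ.parent p j hp hpos'

theorem hierState_append (h : List (V × Fin K × ℝ)) (r : V × Fin K × ℝ) :
    hierState D L pos (h ++ [r]) = hierStep D L pos (hierState D L pos h) r := by
  simp [hierState]

theorem hierInvariant_hierState (hL : 1 ≤ L) (hpos : ∀ c, pos c < 2 ^ L)
    (h : List (V × Fin K × ℝ)) : HierInvariant D L (hierState D L pos h) := by
  induction h using List.reverseRecOn with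
  | nil => constructor <;> simp [hierState]
  | append_singleton h r ih =>
    rw [hierState_append]
    exact hierInvariant_hierStep hL hpos ih r

/-- The copies at the levels `1, …, L`. -/
def hierCopies (L : ℕ) : Finset (ℕ × ℕ) := Finset.Icc 1 L ×ˢ Finset.range (2 ^ L)

/-- The sum of a function of the states of the copies. -/
noncomputable def hierTotal (L : ℕ) (φ : ℕ → ℕ → TsallisState K → ℝ) (σ : HierState K) : ℝ :=
  ∑ x ∈ hierCopies L, φ x.1 x.2 (σ x.1 x.2)

/-- A round touches only the active copy, so the growth of the total is the growth of that copy's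
term, and the totals telescope. -/
theorem hierTotal_hierStep (hL : 1 ≤ L) (hpos : ∀ c, pos c < 2 ^ L)
    (φ : ℕ → ℕ → TsallisState K → ℝ) (σ : HierState K) (r : V × Fin K × ℝ) :
    hierTotal L φ (hierStep D L pos σ r) = hierTotal L φ σ +
      (φ (activeLevel D L σ (pos r.1)) (blockIndex L (activeLevel D L σ (pos r.1)) (pos r.1))
          ((activeState D L σ (pos r.1)).step r.2.1 r.2.2) -
        φ (activeLevel D L σ (pos r.1)) (blockIndex L (activeLevel D L σ (pos r.1)) (pos r.1))
          (activeState D L σ (pos r.1))) := by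
  have h1 := activeLevel_spec D hL σ (pos r.1)
  have h2 := activeLevel_le D hL σ (pos r.1)
  set p := activeLevel D L σ (pos r.1) with hp
  have hmem : (p, blockIndex L p (pos r.1)) ∈ hierCopies L := by
    simp only [hierCopies, Finset.mem_product, Finset.mem_Icc, Finset.mem_range]
    exact ⟨⟨h1.1, h2⟩, (blockIndex_lt h2 (hpos _)).trans_le (Nat.pow_le_pow_right (by norm_num) h2)⟩
  simp only [hierTotal]
  rw [← sub_eq_iff_eq_add', ← Finset.sum_sub_distrib, Finset.sum_eq_single_of_mem _ hmem]
  · simp [hierStep, ← hp, activeState]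
  · rintro ⟨q, j⟩ - hne
    have : ¬ (q = p ∧ j = blockIndex L q (pos r.1)) := by
      rintro ⟨rfl, rfl⟩
      exact hne rfl
    simp [hierStep, ← hp, this]

theorem hierTotal_rounds (hL : 1 ≤ L) (hpos : ∀ c, pos c < 2 ^ L) (h : List (V × Fin K × ℝ)) :
    hierTotal L (fun _ _ s => (s.rounds : ℝ)) (hierState D L pos h) = h.length := by
  induction h using List.reverseRecOn with
  | nil => simp [hierTotal, hierState]
  | append_singleton h r ih =>
    rw [hierState_append, hierTotal_hierStep hL hpos, ih]
    simp [TsallisState.step]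

theorem rounds_le_length (h : List (V × Fin K × ℝ))
    (p j : ℕ) : (hierState D L pos h p j).rounds ≤ h.length := by
  induction h using List.reverseRecOn with
  | nil => simp [hierState]
  | append_singleton h r ih =>
    rw [hierState_append, hierStep]
    split_ifs
    · simpa [TsallisState.step] using ih
    · simp
      omega

/-- Few copies are ever activated. -/
theorem card_activated_le (hL : 1 ≤ L) (hpos : ∀ c, pos c < 2 ^ L) (hD : 1 ≤ D)
    (h : List (V × Fin K × ℝ)) :
    (((hierCopies L).filter fun x => 0 < (hierState D L pos h x.1 x.2).rounds).card : ℝ) ≤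
      2 * (h.length / D) + 2 := by
  classical
  have inv := hierInvariant_hierState (D := D) hL hpos h
  have htot := hierTotal_rounds (D := D) hL hpos h
  set σ := hierState D L pos h with hσ
  set full := (hierCopies L).filter fun x => D ≤ (σ x.1 x.2).rounds with hfull
  -- The rounds of all copies add up to the elapsed time, and a full copy accounts for at least `D`
  -- of them.
  have hfullcard : (full.card : ℝ) ≤ h.length / D := by
    rw [le_div_iff₀ (by exact_mod_cast hD), ← htot, hierTotal, ← nsmul_eq_mul, ← Finset.sum_const]
    refine (Finset.sum_le_sum fun x hx => ?_).trans
      (Finset.sum_le_sum_of_subset_of_nonneg (Finset.filter_subset _ _) fun _ _ _ =>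
        Nat.cast_nonneg _)
    exact_mod_cast (Finset.mem_filter.1 hx).2
  set act := (hierCopies L).filter fun x => 0 < (σ x.1 x.2).rounds with hact
  set par : ℕ × ℕ → ℕ × ℕ := fun x => (x.1 - 1, x.2 / 2) with hpar
  -- The two copies of level `1` have no parent. Each other activated copy is one of the two
  -- children of a full one.
  have h1 : (act.filter fun x => x.1 = 1).card ≤ 2 := by
    have : act.filter (fun x => x.1 = 1) ⊆ {1} ×ˢ Finset.range 2 := by
      rintro ⟨p, j⟩ hx
      simp only [hact, Finset.mem_filter] at hx
      obtain ⟨⟨-, h0⟩, rfl⟩ := hx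
      have := (inv.mem _ _ h0).2.2
      simpa using this
    exact (Finset.card_le_card this).trans (by simp)
  have h2 : (act.filter fun x => ¬ x.1 = 1).card ≤ 2 * full.card := by
    have himg : (act.filter fun x => ¬ x.1 = 1).image par ⊆ full := by
      intro y hy
      obtain ⟨⟨p, j⟩, hx, rfl⟩ := Finset.mem_image.1 hy
      simp only [hact, Finset.mem_filter] at hx
      obtain ⟨⟨-, h0⟩, hp⟩ := hx
      have m := inv.mem _ _ h0
      have hd := inv.parent p j (by omega) h0
      have m' := inv.mem (p - 1) (j / 2) (by omega)
      simp only [hfull, hpar, Finset.mem_filter, hierCopies, Finset.mem_product, Finset.mem_Icc,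
        Finset.mem_range]
      exact ⟨⟨⟨m'.1, m'.2.1⟩, m'.2.2.trans_le (Nat.pow_le_pow_right (by norm_num) m'.2.1)⟩, hd⟩
    refine (Finset.card_le_mul_card_image _ 2 fun y hy => ?_).trans
      (Nat.mul_le_mul_left _ (Finset.card_le_card himg))
    have : (act.filter fun x => ¬ x.1 = 1).filter (fun x => par x = y) ⊆
        {(y.1 + 1, 2 * y.2), (y.1 + 1, 2 * y.2 + 1)} := by
      rintro ⟨p, j⟩ hx
      simp only [Finset.mem_filter, hact] at hx
      obtain ⟨⟨⟨-, h0⟩, hp⟩, rfl⟩ := hx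
      have m := inv.mem _ _ h0
      simp only [hpar, Finset.mem_insert, Finset.mem_singleton, Prod.mk.injEq]
      omega
    exact (Finset.card_le_card this).trans Finset.card_le_two
  have h3 : act.card ≤ 2 * full.card + 2 := by
    rw [← Finset.card_filter_add_card_filter_not (s := act) (fun x => x.1 = 1)]
    omega
  have h4 : (act.card : ℝ) ≤ 2 * full.card + 2 := by exact_mod_cast h3
  linarith

open Classical in
/-- The potential of a copy: the number of rounds for the copies whose block has several
labels, and the potential of Tsallis-INF for the other ones. -/
noncomputable def copyPotential (A : ℝ) (mixed : ℕ → ℕ → Prop) (best : ℕ → ℕ → Fin K) (p j : ℕ)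
    (s : TsallisState K) : ℝ :=
  if mixed p j then (s.rounds : ℝ) else s.regretPotential A (best p j)

theorem hierTotal_copyPotential_nil (A : ℝ) (mixed : ℕ → ℕ → Prop) (best : ℕ → ℕ → Fin K) :
    hierTotal L (copyPotential A mixed best) (hierState D L pos []) = 0 := by
  refine Finset.sum_eq_zero fun x _ => ?_
  simp [copyPotential, hierState, TsallisState.regretPotential, TsallisState.potential]

-- A mixed copy holds at most `D` rounds because it is not at the last level, where copies are never
-- replaced. An unmixed copy contributes only if activated, since the potential of the initial state
-- is `0`.
open Classical in
theorem hierTotal_copyPotential_le (hL : 1 ≤ L) (hpos : ∀ c, pos c < 2 ^ L) (hD : 1 ≤ D)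
    {A : ℝ} (hA : 0 ≤ A) {mixed : ℕ → ℕ → Prop} {F : ℕ} (best : ℕ → ℕ → Fin K)
    (hmixed : ∀ p, ((Finset.range (2 ^ L)).filter (mixed p)).card ≤ F)
    (hlast : ∀ j, ¬ mixed L j) (h : List (V × Fin K × ℝ)) :
    hierTotal L (copyPotential A mixed best) (hierState D L pos h) ≤
      F * L * D + (2 * (h.length / D) + 2) * (4 * K + A * (1 + Real.log h.length)) := by
  have inv := hierInvariant_hierState (D := D) hL hpos h
  have hact := card_activated_le hL hpos hD h
  have hlen := rounds_le_length (D := D) (L := L) (pos := pos) h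
  set σ := hierState D L pos h with hσ
  set B := 4 * (K : ℝ) + A * (1 + Real.log h.length) with hB
  have hB0 : 0 ≤ B := by
    have : 0 ≤ Real.log h.length := Real.log_natCast_nonneg _
    positivity
  have hterm : ∀ x ∈ hierCopies L, copyPotential A mixed best x.1 x.2 (σ x.1 x.2) ≤
      (if mixed x.1 x.2 then (D : ℝ) else 0) + if 0 < (σ x.1 x.2).rounds then B else 0 := by
    rintro ⟨p, j⟩ hx
    simp only [hierCopies, Finset.mem_product, Finset.mem_Icc] at hx
    by_cases hm : mixed p j
    · have hp : p < L := lt_of_le_of_ne hx.1.2 fun e => hlast j (e ▸ hm)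
      have : ((σ p j).rounds : ℝ) ≤ D := by exact_mod_cast inv.rounds_le p j hp
      simp only [copyPotential, if_pos hm]
      split_ifs <;> linarith
    · simp only [copyPotential, if_neg hm]
      rcases Nat.eq_zero_or_pos (σ p j).rounds with h0 | h0
      · rw [inv.eq_init p j h0]
        simp [TsallisState.regretPotential, TsallisState.potential]
      · rw [if_pos h0, TsallisState.regretPotential, zero_add]
        have b1 := (σ p j).potential_le (best p j)
        have b2 : (harmonic (σ p j).rounds : ℝ) ≤ 1 + Real.log h.length := by
          refine (harmonic_le_one_add_log _).trans ?_
          have : Real.log (σ p j).rounds ≤ Real.log h.length :=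
            Real.log_le_log (by exact_mod_cast h0) (by exact_mod_cast hlen p j)
          linarith
        have := mul_le_mul_of_nonneg_left b2 hA
        rw [hB]
        linarith
  refine (Finset.sum_le_sum hterm).trans ?_
  rw [Finset.sum_add_distrib]
  refine add_le_add ?_ ?_
  · rw [hierCopies, Finset.sum_product]
    have : ∀ p ∈ Finset.Icc 1 L, ∑ j ∈ Finset.range (2 ^ L), (if mixed p j then (D : ℝ) else 0) ≤
        F * D := by
      intro p _
      rw [← Finset.sum_filter, Finset.sum_const, nsmul_eq_mul]
      exact mul_le_mul_of_nonneg_right (by exact_mod_cast hmixed p) (Nat.cast_nonneg _)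
    refine (Finset.sum_le_sum this).trans (le_of_eq ?_)
    simp
    ring
  · rw [← Finset.sum_filter, Finset.sum_const, nsmul_eq_mul]
    exact mul_le_mul_of_nonneg_right hact hB0

end Hierarchy

/-! ### Measurability of the states and weights -/

section Measurability

instance {K : ℕ} : MeasurableSpace (TsallisState K) :=
  MeasurableSpace.comap (fun s => (s.rounds, s.est)) inferInstance

theorem TsallisState.measurable_rounds_est {K : ℕ} :
    Measurable fun s : TsallisState K => (s.rounds, s.est) :=
  comap_measurable _

theorem TsallisState.measurable_rounds {K : ℕ} : Measurable (TsallisState.rounds (K := K)) :=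
  measurable_fst.comp measurable_rounds_est

theorem TsallisState.measurable_est {K : ℕ} : Measurable (TsallisState.est (K := K)) :=
  measurable_snd.comp measurable_rounds_est

theorem TsallisState.measurable_mk {α : Type*} [MeasurableSpace α] {K : ℕ}
    {f : α → TsallisState K} (h1 : Measurable fun a => (f a).rounds)
    (h2 : Measurable fun a => (f a).est) : Measurable f :=
  measurable_comap_iff.2 (h1.prodMk h2)

variable {V : Type u} {K : ℕ} [NeZero K]

theorem TsallisState.measurable_weights : Measurable (TsallisState.weights (K := K)) := by
  have h : Measurable fun x : ℕ × (Fin K → ℝ) => tsallisWeights (2 / √((x.1 : ℝ) + 1)) x.2 := by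
    refine measurable_from_prod_countable_right fun n => ?_
    have hn : (0 : ℝ) < 2 / √((n : ℝ) + 1) := by positivity
    exact (continuous_tsallisWeights hn).measurable
  have e : TsallisState.weights (K := K) =
      fun s => tsallisWeights (2 / √(((s.rounds, s.est).1 : ℝ) + 1)) (s.rounds, s.est).2 := by
    ext s i
    simp only [weights]
  rw [e]
  exact h.comp measurable_rounds_est

theorem TsallisState.measurable_weights_apply (i : Fin K) :
    Measurable fun s : TsallisState K => s.weights i :=
  (measurable_pi_apply i).comp measurable_weights

theorem TsallisState.measurable_step :
    Measurable fun x : TsallisState K × Fin K × ℝ => x.1.step x.2.1 x.2.2 := by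
  refine measurable_mk ?_ ?_
  · exact (measurable_of_countable (fun n : ℕ => n + 1)).comp (measurable_rounds.comp measurable_fst)
  · refine measurable_pi_lambda _ fun k => ?_
    have h : Measurable fun y : (TsallisState K × ℝ) × Fin K =>
        y.1.1.est k + if k = y.2 then (1 - y.1.2) / y.1.1.weights y.2 else 0 := by
      refine measurable_from_prod_countable_left fun i => ?_
      have a1 : Measurable fun y : TsallisState K × ℝ => y.1.est k :=
        (measurable_pi_apply k).comp (measurable_est.comp measurable_fst)
      have a2 : Measurable fun y : TsallisState K × ℝ => y.1.weights i :=
        (measurable_weights_apply i).comp measurable_fst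
      by_cases hk : k = i
      · simp only [hk, if_true] at a1 ⊢
        exact a1.add ((measurable_const.sub measurable_snd).div a2)
      · simpa only [hk, if_false, add_zero] using a1
    exact h.comp ((measurable_fst.prodMk (measurable_snd.comp measurable_snd)).prodMk
      (measurable_fst.comp measurable_snd))

omit [NeZero K] in
theorem TsallisState.measurable_rate : Measurable (TsallisState.rate (K := K)) :=
  (measurable_of_countable (fun n : ℕ => √((n : ℝ) + 1))).comp measurable_rounds

theorem TsallisState.measurable_sqrtMass (k : Fin K) :
    Measurable fun s : TsallisState K => s.sqrtMass k :=
  Finset.measurable_fun_sum _ fun i _ => (measurable_weights_apply i).sqrt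

theorem TsallisState.measurable_penalty (k i : Fin K) :
    Measurable fun s : TsallisState K => s.penalty k i := by
  have h1 := measurable_rate (K := K)
  have h2 := measurable_sqrtMass k
  have h3 := measurable_weights_apply i
  unfold penalty
  refine Measurable.div ?_ h3
  split_ifs
  · exact ((h2.const_mul _).div h1).add (measurable_const.div (h1.pow_const 2))
  · exact h3.sqrt.div h1

theorem TsallisState.measurable_growthConst (A : ℝ) (k i : Fin K) :
    Measurable fun s : TsallisState K => s.growthConst A k i := by
  have h1 := measurable_rate (K := K)
  have h2 := measurable_sqrtMass k
  have h3 := measurable_weights_apply k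
  have h4 := measurable_penalty k i
  unfold growthConst
  have h5 : Measurable fun s : TsallisState K => if i = k then 1 / s.weights k else 0 := by
    split_ifs
    · exact measurable_const.div h3
    · exact measurable_const
  exact ((((measurable_const.sub h5).sub h4).sub ((h2.const_mul _).div h1)).const_mul _).add
    (measurable_const.div (h1.pow_const 2))

theorem TsallisState.measurable_growthSlope (k i : Fin K) :
    Measurable fun s : TsallisState K => s.growthSlope k i := by
  have h3 := measurable_weights_apply k
  unfold growthSlope
  refine Measurable.const_mul (Measurable.sub ?_ measurable_const) _
  split_ifs
  · exact measurable_const.div h3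
  · exact measurable_const

omit [NeZero K] in
theorem measurable_activeLevel (D : ℕ) {L : ℕ} (hL : 1 ≤ L) (x : ℕ) :
    Measurable fun σ : HierState K => activeLevel D L σ x := by
  refine measurable_of_Iic fun m => ?_
  -- The infimum is attained because `L` is always admissible.
  have e : (fun σ : HierState K => activeLevel D L σ x) ⁻¹' Set.Iic m =
      ⋃ p ∈ Set.Iic m, {σ | 1 ≤ p ∧ (L ≤ p ∨ (σ p (blockIndex L p x)).rounds < D)} := by
    ext σ
    simp only [Set.mem_preimage, Set.mem_Iic, Set.mem_iUnion, Set.mem_ofPred_eq, exists_prop]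
    exact ⟨fun h => ⟨_, h, activeLevel_spec D hL σ x⟩, fun ⟨p, hp, h⟩ => (Nat.sInf_le h).trans hp⟩
  rw [e]
  refine MeasurableSet.biUnion (Set.to_countable _) fun p _ => ?_
  have h : Measurable fun σ : HierState K => (σ p (blockIndex L p x)).rounds :=
    TsallisState.measurable_rounds.comp ((measurable_pi_apply _).comp (measurable_pi_apply p))
  exact (MeasurableSet.const _).inter ((MeasurableSet.const _).union (h (measurableSet_Iio)))

omit [NeZero K] in
theorem measurable_activeState (D : ℕ) {L : ℕ} (hL : 1 ≤ L) (x : ℕ) :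
    Measurable fun σ : HierState K => activeState D L σ x := by
  have h : Measurable fun y : HierState K × ℕ => y.1 y.2 (blockIndex L y.2 x) := by
    refine measurable_from_prod_countable_left fun p => ?_
    exact (measurable_pi_apply (blockIndex L p x)).comp (measurable_pi_apply p)
  exact h.comp (measurable_id.prodMk (measurable_activeLevel D hL x))

theorem measurable_hierStep [MeasurableSpace V] [DiscreteMeasurableSpace V] [Countable V]
    (D : ℕ) {L : ℕ} (hL : 1 ≤ L) (pos : V → ℕ) :
    Measurable fun y : (HierState K × Fin K × ℝ) × V => hierStep D L pos y.1.1 (y.2, y.1.2) := by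
  refine measurable_from_prod_countable_left fun c => ?_
  refine measurable_pi_lambda _ fun p => measurable_pi_lambda _ fun j => ?_
  have hs : Measurable fun y : HierState K × Fin K × ℝ => y.1 p j :=
    (measurable_pi_apply j).comp ((measurable_pi_apply p).comp measurable_fst)
  simp only [hierStep]
  refine Measurable.ite ?_ (TsallisState.measurable_step.comp (hs.prodMk measurable_snd)) hs
  have h : Measurable fun y : HierState K × Fin K × ℝ => activeLevel D L y.1 (pos c) :=
    (measurable_activeLevel D hL (pos c)).comp measurable_fst
  exact (measurableSet_eq_fun measurable_const h).inter (MeasurableSet.const _)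

end Measurability

/-! ### Conditional expectations in the bandit interaction -/

section Interaction

theorem measurable_of_fibers {α β : Type*} {m : MeasurableSpace α} [MeasurableSpace β]
    [Countable β] {f : α → β} (h : ∀ b, MeasurableSet[m] {a | f a = b}) : Measurable[m] f :=
  measurable_to_countable' h

variable {V : Type u} [Finite V] {K : ℕ} {Ω : Type w}

/-- The states of the copies before round `t` are known at time `t`. -/
theorem IsInteraction.measurable_hierState [NeZero K] {mΩ : MeasurableSpace Ω} {P : Measure Ω} {ℱ : Filtration ℕ mΩ}
    {ν : V → Fin K → Measure ℝ} {π : Policy V K} {T : ℕ} {ctx : ℕ → Ω → V} {arm : ℕ → Ω → Fin K}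
    {rew : ℕ → Ω → ℝ} (H : IsInteraction P ℱ ν π T ctx arm rew) (D : ℕ) {L : ℕ} (hL : 1 ≤ L)
    (pos : V → ℕ) {t : ℕ} (ht : t ≤ T) :
    Measurable[ℱ t] fun ω => hierState D L pos (history ctx arm rew t ω) := by
  let _ : MeasurableSpace V := ⊤
  have : DiscreteMeasurableSpace V := ⟨fun _ => trivial⟩
  induction t with
  | zero => exact measurable_const
  | succ t ih =>
    have e : ∀ ω, hierState (K := K) D L pos (history ctx arm rew (t + 1) ω) =
        hierStep D L pos (hierState D L pos (history ctx arm rew t ω))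
          (ctx t ω, arm t ω, rew t ω) := by
      intro ω
      rw [← hierState_append]
      simp [history, List.range_succ]
    simp only [e]
    have h1 : Measurable[ℱ (t + 1)] fun ω => hierState D L pos (history ctx arm rew t ω) :=
      (ih (by omega)).mono (ℱ.mono t.le_succ) le_rfl
    have h2 : Measurable[ℱ (t + 1)] (ctx t) :=
      Measurable.mono (measurable_of_fibers fun c => H.ctx_meas t ht c)
        (ℱ.mono t.le_succ) le_rfl
    have h3 : Measurable[ℱ (t + 1)] (arm t) := measurable_of_fibers fun i => H.arm_meas t ht i
    exact (measurable_hierStep D hL pos).comp ((h1.prodMk (h3.prodMk (H.rew_meas t ht))).prodMk h2)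

/-- A reward drawn, conditionally on `m`, by a randomized choice of an arm. -/
theorem integral_mul_indicator_arm {m mΩ : MeasurableSpace Ω} {P : Measure Ω}
    [IsProbabilityMeasure P] (hm : m ≤ mΩ)
    {ν : V → Fin K → Measure ℝ} (hν : IsRewardModel ν) {X : Ω → V} {I : Ω → Fin K} {Y : Ω → ℝ}
    {W : Ω → ℝ} {i : Fin K} (hX : ∀ c, MeasurableSet[m] {ω | X ω = c})
    (hI : MeasurableSet {ω | I ω = i}) (hY : Measurable Y) (hW : Measurable[m] W)
    (hW0 : ∀ ω, 0 ≤ W ω) (hW1 : ∀ ω, W ω ≤ 1)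
    (law : ∀ A, MeasurableSet[m] A → ∀ B, MeasurableSet B → P (A ∩ {ω | I ω = i ∧ Y ω ∈ B}) =
      ∫⁻ ω in A, ENNReal.ofReal (W ω) * ν (X ω) i B ∂P)
    {f : Ω → ℝ} (hf : Measurable[m] f) {M : ℝ} (hfW : ∀ ω, |f ω * W ω| ≤ M)
    {g : ℝ → ℝ} (hg : Measurable g) (hg1 : ∀ x, |g x| ≤ 1) :
    Integrable (fun ω => f ω * {ω | I ω = i}.indicator (fun ω => g (Y ω)) ω) P ∧
      ∫ ω, f ω * {ω | I ω = i}.indicator (fun ω => g (Y ω)) ω ∂P =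
        ∫ ω, f ω * (W ω * ∫ x, g x ∂(ν (X ω) i)) ∂P := by
  have := fun c => hν.prob c i
  have hWm : Measurable W := hW.mono hm le_rfl
  have hfm : Measurable f := hf.mono hm le_rfl
  have hind : Measurable ({ω | I ω = i}.indicator fun ω => g (Y ω)) :=
    (hg.comp hY).indicator hI
  have hgint : Integrable ({ω | I ω = i}.indicator fun ω => g (Y ω)) P := by
    refine Integrable.of_bound hind.aestronglyMeasurable 1 (Filter.Eventually.of_forall fun ω => ?_)
    refine (norm_indicator_le_norm_self _ _).trans ?_
    exact hg1 _
  -- Seen from `m`, restricting to the event that arm `i` is played amounts to the density `W`. Thus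
  -- `f` may be unbounded, like an inverse weight, as long as `f * W` is bounded.
  have htrim : (P.restrict {ω | I ω = i}).trim hm =
      (P.withDensity fun ω => ENNReal.ofReal (W ω)).trim hm := by
    refine @Measure.ext _ m _ _ fun A hA => ?_
    rw [trim_measurableSet_eq hm hA, trim_measurableSet_eq hm hA, Measure.restrict_apply (hm A hA),
      withDensity_apply _ (hm A hA)]
    have := law A hA Set.univ MeasurableSet.univ
    simpa using this
  have hint : Integrable (fun ω => f ω * {ω | I ω = i}.indicator (fun ω => g (Y ω)) ω) P := by
    refine ⟨(hfm.mul hind).aestronglyMeasurable, ?_⟩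
    rw [hasFiniteIntegral_iff_enorm]
    have hfe : Measurable[m] fun ω => ‖f ω‖ₑ := measurable_enorm.comp hf
    calc ∫⁻ ω, ‖f ω * {ω | I ω = i}.indicator (fun ω => g (Y ω)) ω‖ₑ ∂P
        ≤ ∫⁻ ω, {ω | I ω = i}.indicator (fun ω => ‖f ω‖ₑ) ω ∂P := by
          refine lintegral_mono fun ω => ?_
          by_cases h : I ω = i
          · simp only [Set.indicator, Set.mem_ofPred_eq, h, if_true, enorm_mul]
            refine mul_le_of_le_one_right' ?_
            rw [← ofReal_norm, ENNReal.ofReal_le_one]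
            exact hg1 _
          · simp [Set.indicator, h]
      _ = ∫⁻ ω, ‖f ω‖ₑ ∂(P.withDensity fun ω => ENNReal.ofReal (W ω)) := by
          rw [lintegral_indicator hI, ← lintegral_trim hm hfe, htrim, lintegral_trim hm hfe]
      _ = ∫⁻ ω, ENNReal.ofReal (W ω) * ‖f ω‖ₑ ∂P := by
          rw [lintegral_withDensity_eq_lintegral_mul _ hWm.ennreal_ofReal hfm.enorm]
          rfl
      _ ≤ ∫⁻ _, ENNReal.ofReal M ∂P := by
          refine lintegral_mono fun ω => ?_
          rw [← ofReal_norm, ← ENNReal.ofReal_mul (hW0 ω)]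
          refine ENNReal.ofReal_le_ofReal ?_
          have := hfW ω
          rw [abs_mul, abs_of_nonneg (hW0 ω)] at this
          rwa [Real.norm_eq_abs, mul_comm]
      _ < ⊤ := by simp
  refine ⟨hint, ?_⟩
  cases nonempty_fintype V
  have hXm : Measurable[m] fun ω => ∫ x, g x ∂(ν (X ω) i) := by
    let _ : MeasurableSpace V := ⊤
    exact (measurable_of_countable fun c => ∫ x, g x ∂(ν c i)).comp
      (measurable_of_fibers hX)
  have hgν : ∀ c, |∫ x, g x ∂(ν c i)| ≤ 1 := by
    intro c
    have := norm_integral_le_of_norm_le_const (μ := ν c i) (f := g) (C := 1)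
      (Filter.Eventually.of_forall fun x => hg1 x)
    simpa using this
  have hWint : Integrable W P :=
    Integrable.of_bound hWm.aestronglyMeasurable 1 (Filter.Eventually.of_forall fun ω => by
      rw [Real.norm_eq_abs, abs_of_nonneg (hW0 ω)]; exact hW1 ω)
  have hWg : Integrable (fun ω => W ω * ∫ x, g x ∂(ν (X ω) i)) P := by
    refine Integrable.of_bound (hWm.mul (hXm.mono hm le_rfl)).aestronglyMeasurable 1
      (Filter.Eventually.of_forall fun ω => ?_)
    rw [Real.norm_eq_abs, abs_mul, abs_of_nonneg (hW0 ω)]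
    exact mul_le_one₀ (hW1 ω) (abs_nonneg _) (hgν _)
  have hcond : (fun ω => W ω * ∫ x, g x ∂(ν (X ω) i)) =ᵐ[P]
      P[{ω | I ω = i}.indicator (fun ω => g (Y ω)) | m] := by
    refine ae_eq_condExp_of_forall_setIntegral_eq hm hgint (fun _ _ _ => hWg.integrableOn) ?_
      (hW.mul hXm).stronglyMeasurable.aestronglyMeasurable
    intro A hA _
    -- On each of these finitely many pieces the context is fixed, so the reward law is a multiple
    -- of a single `ν c i`.
    have hU : A = ⋃ c, A ∩ {ω | X ω = c} := by
      ext ω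
      simp
    have hmeas : ∀ c, MeasurableSet[m] (A ∩ {ω | X ω = c}) := fun c => hA.inter (hX c)
    have hdisj : Pairwise (Function.onFun Disjoint fun c => A ∩ {ω | X ω = c}) := by
      intro c c' hne
      refine Set.disjoint_left.2 fun ω h1 h2 => hne ?_
      exact h1.2.symm.trans h2.2
    rw [hU, integral_iUnion_fintype (fun c => hm _ (hmeas c)) hdisj fun c => hWg.integrableOn,
      integral_iUnion_fintype (fun c => hm _ (hmeas c)) hdisj fun c => hgint.integrableOn]
    refine Finset.sum_congr rfl fun c _ => ?_
    set S := A ∩ {ω | X ω = c} with hS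
    have hSm : MeasurableSet S := hm _ (hmeas c)
    have hmap : (P.restrict (S ∩ {ω | I ω = i})).map Y =
        (∫⁻ ω in S, ENNReal.ofReal (W ω) ∂P) • ν c i := by
      refine Measure.ext fun B hB => ?_
      rw [Measure.map_apply hY hB, Measure.restrict_apply (hY hB), Measure.smul_apply, smul_eq_mul,
        ← lintegral_mul_const _ hWm.ennreal_ofReal]
      have e : Y ⁻¹' B ∩ (S ∩ {ω | I ω = i}) = S ∩ {ω | I ω = i ∧ Y ω ∈ B} := by
        ext ω
        simp only [Set.mem_inter_iff, Set.mem_preimage, Set.mem_ofPred_eq]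
        tauto
      rw [e, law S (hmeas c) B hB]
      refine setLIntegral_congr_fun hSm fun ω hω => ?_
      have : X ω = c := hω.2
      simp only [this]
    rw [setIntegral_indicator hI,
      ← integral_map (f := g) hY.aemeasurable hg.aestronglyMeasurable, hmap,
      integral_smul_measure]
    have e1 : ∫ ω in S, W ω * ∫ x, g x ∂(ν (X ω) i) ∂P = ∫ ω in S, W ω * ∫ x, g x ∂(ν c i) ∂P := by
      refine setIntegral_congr_fun hSm fun ω hω => ?_
      have : X ω = c := hω.2
      simp only [this]
    rw [e1, integral_mul_const, integral_eq_lintegral_of_nonneg_ae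
      (Filter.Eventually.of_forall hW0) hWm.aestronglyMeasurable, smul_eq_mul]
  have hpull := condExp_mul_of_stronglyMeasurable_left (μ := P) (m := m) hf.stronglyMeasurable
    (g := {ω | I ω = i}.indicator (fun ω => g (Y ω))) hint hgint
  rw [← integral_condExp hm]
  refine integral_congr_ae ?_
  refine Filter.EventuallyEq.trans hpull ?_
  filter_upwards [hcond] with ω h
  simp only [Pi.mul_apply]
  rw [← h]

end Interaction

/-! ### Regret bound for the hierarchical algorithm -/

section RegretBound

variable {V : Type u} {K : ℕ} {ν : V → Fin K → Measure ℝ}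

theorem IsRewardModel.integrable_id (hν : IsRewardModel ν) (c : V) (i : Fin K) :
    Integrable (fun x => x) (ν c i) := by
  have := hν.prob c i
  refine Integrable.of_bound measurable_id.aestronglyMeasurable 1 ?_
  filter_upwards [hν.mem_unit c i] with x hx
  rw [Real.norm_eq_abs, abs_of_nonneg hx.1]
  exact hx.2

theorem IsRewardModel.armMean_mem (hν : IsRewardModel ν) (c : V) (i : Fin K) :
    armMean ν c i ∈ Set.Icc (0 : ℝ) 1 := by
  have := hν.prob c i
  constructor
  · refine integral_nonneg_of_ae ?_
    filter_upwards [hν.mem_unit c i] with x hx using hx.1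
  · have := integral_mono_ae (hν.integrable_id c i) (integrable_const (1 : ℝ)) (by
      filter_upwards [hν.mem_unit c i] with x hx using hx.2)
    simpa [armMean] using this

theorem armMean_le_bestMean (c : V) (i : Fin K) : armMean ν c i ≤ bestMean ν c :=
  le_ciSup (Set.finite_range _).bddAbove i

theorem gap_nonneg (c : V) (i : Fin K) : 0 ≤ gap ν c i := sub_nonneg.2 (armMean_le_bestMean c i)

theorem IsRewardModel.gap_le_one (hν : IsRewardModel ν) (c : V) (i : Fin K) : gap ν c i ≤ 1 := by
  have : Nonempty (Fin K) := ⟨i⟩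
  have h : bestMean ν c ≤ 1 := ciSup_le fun i => (hν.armMean_mem c i).2
  have := (hν.armMean_mem c i).1
  rw [gap]
  linarith

theorem IsRewardModel.integral_clamp (hν : IsRewardModel ν) (c : V) (i : Fin K) :
    ∫ x, max 0 (min x 1) ∂(ν c i) = armMean ν c i := by
  refine integral_congr_ae ?_
  filter_upwards [hν.mem_unit c i] with x hx
  rw [min_eq_left hx.2, max_eq_right hx.1]

variable {Ω : Type w}

theorem IsInteraction.ae_rew_mem {mΩ : MeasurableSpace Ω} {P : Measure Ω} {ℱ : Filtration ℕ mΩ}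
    {π : Policy V K} {T : ℕ} {ctx : ℕ → Ω → V} {arm : ℕ → Ω → Fin K} {rew : ℕ → Ω → ℝ}
    (H : IsInteraction P ℱ ν π T ctx arm rew) (hν : IsRewardModel ν) :
    ∀ᵐ ω ∂P, ∀ t < T, rew t ω ∈ Set.Icc (0 : ℝ) 1 := by
  rw [ae_all_iff]
  intro t
  by_cases ht : t < T
  swap
  · exact Filter.Eventually.of_forall fun _ h => absurd h ht
  have h : ∀ i : Fin K, ∀ᵐ ω ∂P, ¬ (arm t ω = i ∧ rew t ω ∈ (Set.Icc (0 : ℝ) 1)ᶜ) := by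
    intro i
    rw [ae_iff]
    have := H.law t ht Set.univ MeasurableSet.univ i (Set.Icc 0 1)ᶜ measurableSet_Icc.compl
    simp only [Set.univ_inter] at this
    simp only [not_not]
    rw [this]
    have h0 : ∀ c, ν c i (Set.Icc 0 1)ᶜ = 0 := fun c => hν.mem_unit c i
    simp [h0]
  filter_upwards [ae_all_iff.2 h] with ω hω _
  by_contra hc
  exact hω _ ⟨rfl, hc⟩

namespace TsallisState

variable [NeZero K]

/-- The coefficient contains inverse weights and is unbounded; its product with the probability of
the arm is what `integral_mul_indicator_arm` requires to be bounded. -/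
theorem abs_growthConst_mul_weights_le {A : ℝ} (hA : 0 ≤ A) (k i : Fin K) (s : TsallisState K) :
    |s.growthConst A k i * s.weights i| ≤ 22 * K + 12 + A := by
  have h1 := s.weights_mul_penalty_mem k i
  have h2 := s.weights_pos i
  have h3 := s.weights_le_one i
  have hR := s.one_le_rate
  have hRp := s.rate_pos
  have h4 : 0 ≤ s.sqrtMass k / s.rate ∧ s.sqrtMass k / s.rate ≤ K := by
    have h0 := s.sqrtMass_nonneg k
    refine ⟨by positivity, (div_le_self h0 hR).trans ?_⟩
    have := s.sum_sqrt_weights_le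
    rw [s.sum_sqrt_weights k] at this
    linarith [Real.sqrt_nonneg (s.weights k)]
  have h5 : 0 ≤ A / s.rate ^ 2 ∧ A / s.rate ^ 2 ≤ A :=
    ⟨by positivity, div_le_self hA (one_le_pow₀ hR)⟩
  have h6 : 0 ≤ (if i = k then 1 / s.weights k else 0) * s.weights i ∧
      (if i = k then 1 / s.weights k else 0) * s.weights i ≤ 1 := by
    by_cases h : i = k
    · subst h
      simp [h2.ne']
    · simp [h]
  have h7 : 0 ≤ s.sqrtMass k / s.rate * s.weights i ∧ s.sqrtMass k / s.rate * s.weights i ≤ K :=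
    ⟨mul_nonneg h4.1 h2.le, (mul_le_of_le_one_right h4.1 h3).trans h4.2⟩
  have h8 : 0 ≤ A / s.rate ^ 2 * s.weights i ∧ A / s.rate ^ 2 * s.weights i ≤ A :=
    ⟨mul_nonneg h5.1 h2.le, (mul_le_of_le_one_right h5.1 h3).trans h5.2⟩
  have e : s.growthConst A k i * s.weights i = 2 * s.weights i -
      2 * ((if i = k then 1 / s.weights k else 0) * s.weights i) -
      2 * (s.weights i * s.penalty k i) - 4 * (s.sqrtMass k / s.rate * s.weights i) +
      A / s.rate ^ 2 * s.weights i := by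
    rw [growthConst]
    ring
  rw [e, abs_le]
  have hK : (0 : ℝ) ≤ K := Nat.cast_nonneg _
  constructor <;> linarith [h1.1, h1.2, h6.1, h6.2, h7.1, h7.2, h8.1, h8.2]

theorem abs_growthSlope_mul_weights_le (k i : Fin K) (s : TsallisState K) :
    |s.growthSlope k i * s.weights i| ≤ 2 := by
  have h2 := s.weights_pos i
  have h3 := s.weights_le_one i
  rw [growthSlope, abs_le]
  by_cases h : i = k
  · subst h
    have : 2 * ((if i = i then 1 / s.weights i else 0) - 1) * s.weights i =
        2 * (1 - s.weights i) := by
      rw [if_pos rfl]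
      field_simp
    rw [this]
    constructor <;> linarith
  · simp only [h, if_false]
    constructor <;> linarith

end TsallisState

open Classical in
/-- Pseudo-regret of the hierarchical algorithm when at most `F` blocks of every level are `mixed`
and the contexts of a block that is not have the same reward distributions. -/
theorem hierPolicy_pseudoRegret_le [Finite V] [NeZero K] {δ A : ℝ} (hν : IsRewardModel ν)
    (hE : IsEasy ν δ) (hδ : 0 < δ) (hA : 121 * K / δ + 8 ≤ A) {D L F T : ℕ} {pos : V → ℕ}
    (hL : 1 ≤ L) (hpos : ∀ c, pos c < 2 ^ L) (hD : 1 ≤ D) {mixed : ℕ → ℕ → Prop}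
    (hmixed : ∀ p, ((Finset.range (2 ^ L)).filter (mixed p)).card ≤ F)
    (hlast : ∀ j, ¬ mixed L j)
    (hpure : ∀ p c c', ¬ mixed p (blockIndex L p (pos c)) →
      blockIndex L p (pos c) = blockIndex L p (pos c') → ∀ i, ν c i = ν c' i)
    {mΩ : MeasurableSpace Ω} {P : Measure Ω} [IsProbabilityMeasure P] {ℱ : Filtration ℕ mΩ}
    {ctx : ℕ → Ω → V} {arm : ℕ → Ω → Fin K} {rew : ℕ → Ω → ℝ}
    (H : IsInteraction P ℱ ν (hierPolicy D L pos) T ctx arm rew) :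
    pseudoRegret P ν T ctx arm ≤
      F * L * D + (2 * (T / D) + 2) * (4 * K + A * (1 + Real.log T)) := by
  have hA0 : 0 ≤ A := le_trans (by positivity) hA
  -- The contexts of an unmixed block have equal reward laws, hence a common best arm; a block
  -- without contexts receives an arbitrary one.
  obtain ⟨best, hbest⟩ : ∃ best : ℕ → ℕ → Fin K, ∀ p c, ¬ mixed p (blockIndex L p (pos c)) →
      gap ν c (best p (blockIndex L p (pos c))) = 0 := by
    have : ∀ p j, ∃ k : Fin K, ∀ c, blockIndex L p (pos c) = j → ¬ mixed p j → gap ν c k = 0 := by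
      intro p j
      by_cases h : ∃ c, blockIndex L p (pos c) = j
      · obtain ⟨c, rfl⟩ := h
        obtain ⟨k, hk, -⟩ := hE.unique_best c
        refine ⟨k, fun c' hc' hm => ?_⟩
        have := hpure p c c' hm hc'.symm
        simp only [gap, bestMean, armMean] at hk ⊢
        simpa only [this] using hk
      · exact ⟨0, fun c hc => absurd ⟨c, hc⟩ h⟩
    choose best hb using this
    exact ⟨best, fun p c hm => hb p _ c rfl hm⟩
  set σ : ℕ → Ω → HierState K := fun t ω => hierState D L pos (history ctx arm rew t ω) with hσ
  set s : ℕ → Ω → TsallisState K := fun t ω => activeState D L (σ t ω) (pos (ctx t ω)) with hs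
  set lev : ℕ → Ω → ℕ := fun t ω => activeLevel D L (σ t ω) (pos (ctx t ω)) with hlev
  set blk : ℕ → Ω → ℕ := fun t ω => blockIndex L (lev t ω) (pos (ctx t ω)) with hblk
  -- `a + b * reward` bounds from below the growth of `copyPotential` of the active copy; for a
  -- mixed copy this growth is exactly `1`.
  set a : ℕ → Fin K → Ω → ℝ := fun t i ω => if mixed (lev t ω) (blk t ω) then 1 else
    (s t ω).growthConst A (best (lev t ω) (blk t ω)) i with ha
  set b : ℕ → Fin K → Ω → ℝ := fun t i ω => if mixed (lev t ω) (blk t ω) then 0 else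
    (s t ω).growthSlope (best (lev t ω) (blk t ω)) i with hb
  let _ : MeasurableSpace V := ⊤
  have hctx : ∀ t < T, Measurable[ℱ t] (ctx t) := fun t ht => measurable_of_fibers (H.ctx_meas t ht)
  have hσm : ∀ t < T, Measurable[ℱ t] (σ t) := fun t ht => H.measurable_hierState D hL pos ht.le
  have hsm : ∀ t < T, Measurable[ℱ t] (s t) := by
    intro t ht
    have : Measurable fun y : HierState K × V => activeState D L y.1 (pos y.2) :=
      measurable_from_prod_countable_left fun c => measurable_activeState D hL (pos c)
    exact this.comp ((hσm t ht).prodMk (hctx t ht))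
  have hlevm : ∀ t < T, Measurable[ℱ t] (lev t) := by
    intro t ht
    have : Measurable fun y : HierState K × V => activeLevel D L y.1 (pos y.2) :=
      measurable_from_prod_countable_left fun c => measurable_activeLevel D hL (pos c)
    exact this.comp ((hσm t ht).prodMk (hctx t ht))
  have ham : ∀ t < T, ∀ i, Measurable[ℱ t] (a t i) := by
    intro t ht i
    have : Measurable fun y : TsallisState K × ℕ × V =>
        if mixed y.2.1 (blockIndex L y.2.1 (pos y.2.2)) then 1 else
          y.1.growthConst A (best y.2.1 (blockIndex L y.2.1 (pos y.2.2))) i := by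
      refine measurable_from_prod_countable_left fun y => ?_
      by_cases h : mixed y.1 (blockIndex L y.1 (pos y.2))
      · simp only [h, if_true]
        exact measurable_const
      · simp only [h, if_false]
        exact TsallisState.measurable_growthConst A _ i
    exact this.comp ((hsm t ht).prodMk ((hlevm t ht).prodMk (hctx t ht)))
  have hbm : ∀ t < T, ∀ i, Measurable[ℱ t] (b t i) := by
    intro t ht i
    have : Measurable fun y : TsallisState K × ℕ × V =>
        if mixed y.2.1 (blockIndex L y.2.1 (pos y.2.2)) then 0 else
          y.1.growthSlope (best y.2.1 (blockIndex L y.2.1 (pos y.2.2))) i := by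
      refine measurable_from_prod_countable_left fun y => ?_
      by_cases h : mixed y.1 (blockIndex L y.1 (pos y.2))
      · simp only [h, if_true]
        exact measurable_const
      · simp only [h, if_false]
        exact TsallisState.measurable_growthSlope _ i
    exact this.comp ((hsm t ht).prodMk ((hlevm t ht).prodMk (hctx t ht)))
  have haM : ∀ t i ω, |a t i ω * (s t ω).weights i| ≤ 22 * K + 12 + A := by
    intro t i ω
    simp only [ha]
    split_ifs
    · have h2 := (s t ω).weights_pos i
      have h3 := (s t ω).weights_le_one i
      rw [one_mul, abs_of_pos h2]
      linarith [Nat.cast_nonneg (α := ℝ) K]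
    · exact TsallisState.abs_growthConst_mul_weights_le hA0 _ _ _
  have hbM : ∀ t i ω, |b t i ω * (s t ω).weights i| ≤ 2 := by
    intro t i ω
    simp only [hb]
    split_ifs
    · simp
    · exact TsallisState.abs_growthSlope_mul_weights_le _ _ _
  have key : ∀ t < T, ∀ i, ∀ {f : Ω → ℝ}, Measurable[ℱ t] f → ∀ {M : ℝ},
      (∀ ω, |f ω * (s t ω).weights i| ≤ M) → ∀ {g : ℝ → ℝ}, Measurable g → (∀ x, |g x| ≤ 1) →
      Integrable (fun ω => f ω * {ω | arm t ω = i}.indicator (fun ω => g (rew t ω)) ω) P ∧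
        ∫ ω, f ω * {ω | arm t ω = i}.indicator (fun ω => g (rew t ω)) ω ∂P =
          ∫ ω, f ω * ((s t ω).weights i * ∫ x, g x ∂(ν (ctx t ω) i)) ∂P := by
    intro t ht i f hf M hM g hg hg1
    exact integral_mul_indicator_arm (ℱ.le t) hν (H.ctx_meas t ht)
      (ℱ.le (t + 1) _ (H.arm_meas t ht i)) ((H.rew_meas t ht).mono (ℱ.le (t + 1)) le_rfl)
      ((TsallisState.measurable_weights_apply i).comp (hsm t ht))
      (fun ω => ((s t ω).weights_pos i).le) (fun ω => (s t ω).weights_le_one i)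
      (fun B hB C hC => H.law t ht B hB i C hC) hf hM hg hg1
  -- Rewards lie in `[0,1]` only almost surely, whereas `key` wants a test function bounded
  -- everywhere. Clamping changes neither the means nor almost any path.
  have hclamp : Measurable fun x : ℝ => max 0 (min x 1) := by fun_prop
  have hclamp1 : ∀ x : ℝ, |max 0 (min x 1)| ≤ 1 := fun x => by
    rw [abs_of_nonneg (le_max_left _ _)]
    exact max_le zero_le_one (min_le_right _ _)
  have hone1 : ∀ _x : ℝ, |(1 : ℝ)| ≤ 1 := fun _ => by simp
  set G : ℕ → Ω → ℝ := fun t ω => ∑ i,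
    (a t i ω * {ω | arm t ω = i}.indicator (fun _ => 1) ω +
      b t i ω * {ω | arm t ω = i}.indicator (fun ω => max 0 (min (rew t ω) 1)) ω) with hG
  have hGint : ∀ t < T, Integrable (G t) P := fun t ht =>
    integrable_finsetSum _ fun i _ =>
      (key t ht i (ham t ht i) (haM t i) (g := fun _ => 1) measurable_const hone1).1.add
        (key t ht i (hbm t ht i) (hbM t i) hclamp hclamp1).1
  have hgapm : ∀ t < T, ∀ i, Measurable[ℱ t] fun ω => gap ν (ctx t ω) i := fun t ht i =>
    (measurable_of_countable fun c : V => gap ν c i).comp (hctx t ht)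
  have hgapM : ∀ t i ω, |gap ν (ctx t ω) i * (s t ω).weights i| ≤ 1 := by
    intro t i ω
    have h2 := (s t ω).weights_pos i
    rw [abs_of_nonneg (mul_nonneg (gap_nonneg _ _) h2.le)]
    exact mul_le_one₀ (hν.gap_le_one _ _) h2.le ((s t ω).weights_le_one i)
  have hregret : ∀ t ω, bestMean ν (ctx t ω) - armMean ν (ctx t ω) (arm t ω) =
      ∑ i, gap ν (ctx t ω) i * {ω | arm t ω = i}.indicator (fun _ => 1) ω := by
    intro t ω
    rw [Finset.sum_eq_single (arm t ω)]
    · simp [Set.indicator, gap]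
    · intro i _ hi
      simp [Set.indicator, hi.symm]
    · simp
  have hRint : ∀ t < T, Integrable
      (fun ω => bestMean ν (ctx t ω) - armMean ν (ctx t ω) (arm t ω)) P := by
    intro t ht
    simp only [hregret]
    exact integrable_finsetSum _ fun i _ =>
      (key t ht i (hgapm t ht i) (hgapM t i) (g := fun _ => 1) measurable_const hone1).1
  -- Both sides are integrated conditionally on `ℱ t`; it remains to compare sums over arms at a
  -- fixed `ω`.
  have hstep : ∀ t < T, ∫ ω, (bestMean ν (ctx t ω) - armMean ν (ctx t ω) (arm t ω)) ∂P ≤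
      ∫ ω, G t ω ∂P := by
    intro t ht
    have hbdd : ∀ i, ∀ {f : Ω → ℝ}, Measurable[ℱ t] f → ∀ {M : ℝ},
        (∀ ω, |f ω * (s t ω).weights i| ≤ M) → ∀ {g : ℝ → ℝ}, (∀ x, |g x| ≤ 1) →
        Integrable (fun ω => f ω * ((s t ω).weights i * ∫ x, g x ∂(ν (ctx t ω) i))) P := by
      intro i f hf M hM g hg1
      have hm : Measurable[ℱ t] fun ω => f ω * ((s t ω).weights i * ∫ x, g x ∂(ν (ctx t ω) i)) :=
        hf.mul (((TsallisState.measurable_weights_apply i).comp (hsm t ht)).mul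
          ((measurable_of_countable fun c : V => ∫ x, g x ∂(ν c i)).comp (hctx t ht)))
      refine Integrable.of_bound (hm.mono (ℱ.le t) le_rfl).aestronglyMeasurable M
        (Filter.Eventually.of_forall fun ω => ?_)
      have := hν.prob (ctx t ω) i
      have h1 : |∫ x, g x ∂(ν (ctx t ω) i)| ≤ 1 := by
        have := norm_integral_le_of_norm_le_const (μ := ν (ctx t ω) i) (f := g) (C := 1)
          (Filter.Eventually.of_forall fun x => hg1 x)
        simpa using this
      rw [← mul_assoc, Real.norm_eq_abs, abs_mul]
      exact (mul_le_of_le_one_right (abs_nonneg _) h1).trans (hM ω)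
    have i1 := fun i => key t ht i (hgapm t ht i) (hgapM t i) (g := fun _ => 1)
      measurable_const hone1
    have i2 := fun i => key t ht i (ham t ht i) (haM t i) (g := fun _ => 1) measurable_const hone1
    have i3 := fun i => key t ht i (hbm t ht i) (hbM t i) hclamp hclamp1
    have j1 := fun i => hbdd i (hgapm t ht i) (hgapM t i) (g := fun _ => 1) hone1
    have j2 := fun i => hbdd i (ham t ht i) (haM t i) (g := fun _ => 1) hone1
    have j3 := fun i => hbdd i (hbm t ht i) (hbM t i) hclamp1
    have i23 : ∀ i, Integrable (fun ω => a t i ω * {ω | arm t ω = i}.indicator (fun _ => 1) ω +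
        b t i ω * {ω | arm t ω = i}.indicator (fun ω => max 0 (min (rew t ω) 1)) ω) P :=
      fun i => (i2 i).1.add (i3 i).1
    have j23 : ∀ i, Integrable (fun ω =>
        a t i ω * ((s t ω).weights i * ∫ _, (1 : ℝ) ∂(ν (ctx t ω) i)) +
          b t i ω * ((s t ω).weights i * ∫ x, max 0 (min x 1) ∂(ν (ctx t ω) i))) P :=
      fun i => (j2 i).add (j3 i)
    simp only [hregret, hG]
    rw [integral_finsetSum _ fun i _ => (i1 i).1, integral_finsetSum _ fun i _ => i23 i]
    have e2 : ∀ i, ∫ ω, (a t i ω * {ω | arm t ω = i}.indicator (fun _ => 1) ω +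
        b t i ω * {ω | arm t ω = i}.indicator (fun ω => max 0 (min (rew t ω) 1)) ω) ∂P =
        ∫ ω, (a t i ω * ((s t ω).weights i * ∫ _, (1 : ℝ) ∂(ν (ctx t ω) i)) +
          b t i ω * ((s t ω).weights i * ∫ x, max 0 (min x 1) ∂(ν (ctx t ω) i))) ∂P := by
      intro i
      rw [integral_add (i2 i).1 (i3 i).1, (i2 i).2, (i3 i).2, integral_add (j2 i) (j3 i)]
    simp only [fun i => (i1 i).2, e2]
    rw [← integral_finsetSum _ fun i _ => j1 i, ← integral_finsetSum _ fun i _ => j23 i]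
    refine integral_mono (integrable_finsetSum _ fun i _ => j1 i)
      (integrable_finsetSum _ fun i _ => j23 i) fun ω => ?_
    have hprob := fun i => hν.prob (ctx t ω) i
    simp only [hν.integral_clamp, integral_const, probReal_univ, smul_eq_mul, mul_one]
    by_cases hm : mixed (lev t ω) (blk t ω)
    · simp only [ha, hb, hm, if_true, one_mul, zero_mul, add_zero]
      refine Finset.sum_le_sum fun i _ => ?_
      exact mul_le_of_le_one_left ((s t ω).weights_pos i).le (hν.gap_le_one _ _)
    · simp only [ha, hb, hm, if_false]
      set k := best (lev t ω) (blk t ω) with hk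
      have hk0 : gap ν (ctx t ω) k = 0 := hbest _ _ hm
      have := (s t ω).sum_weights_mul_gap_le k hδ hA (m := bestMean ν (ctx t ω))
        (μ := armMean ν (ctx t ω)) (sub_eq_zero.1 hk0).symm fun i hi => by
          refine hE.le_gap _ _ ((gap_nonneg _ _).lt_of_ne' fun h0 => hi ?_)
          exact (hE.unique_best (ctx t ω)).unique h0 hk0
      refine le_trans (le_of_eq ?_) (this.trans (le_of_eq ?_))
      · exact Finset.sum_congr rfl fun i _ => mul_comm _ _
      · exact Finset.sum_congr rfl fun i _ => by ring
  -- Almost surely the increments telescope to the final total potential, which has a deterministic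
  -- cap.
  have hpath : ∀ᵐ ω ∂P, ∑ t ∈ Finset.range T, G t ω ≤
      F * L * D + (2 * (T / D) + 2) * (4 * K + A * (1 + Real.log T)) := by
    filter_upwards [H.ae_rew_mem hν] with ω hω
    have hinc : ∀ t ∈ Finset.range T, G t ω ≤
        hierTotal L (copyPotential A mixed best) (σ (t + 1) ω) -
          hierTotal L (copyPotential A mixed best) (σ t ω) := by
      intro t ht
      have hr := hω t (Finset.mem_range.1 ht)
      have e : σ (t + 1) ω = hierStep D L pos (σ t ω) (ctx t ω, arm t ω, rew t ω) := by
        simp only [hσ]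
        rw [← hierState_append]
        simp [history, List.range_succ]
      rw [e, hierTotal_hierStep hL hpos, add_sub_cancel_left]
      have eG : G t ω = a t (arm t ω) ω + b t (arm t ω) ω * rew t ω := by
        simp only [hG]
        rw [Finset.sum_eq_single (arm t ω)]
        · simp [Set.indicator, min_eq_left hr.2, max_eq_right hr.1]
        · intro i _ hi
          simp [Set.indicator, hi.symm]
        · simp
      rw [eG]
      change _ ≤ copyPotential A mixed best (lev t ω) (blk t ω)
        ((s t ω).step (arm t ω) (rew t ω)) -
          copyPotential A mixed best (lev t ω) (blk t ω) (s t ω)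
      by_cases hm : mixed (lev t ω) (blk t ω)
      · simp [ha, hb, copyPotential, hm, TsallisState.step]
      · simp only [ha, hb, copyPotential, hm, if_false]
        exact (s t ω).growth_le A _ _ hr.1 hr.2
    refine (Finset.sum_le_sum hinc).trans ?_
    rw [Finset.sum_range_sub (fun t => hierTotal L (copyPotential A mixed best) (σ t ω))]
    have e0 : σ 0 ω = hierState D L pos [] := rfl
    rw [e0, hierTotal_copyPotential_nil, sub_zero]
    have := hierTotal_copyPotential_le hL hpos hD hA0 best hmixed hlast (history ctx arm rew T ω)
    have hlen : (history ctx arm rew T ω).length = T := by simp [history]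
    rwa [hlen] at this
  calc pseudoRegret P ν T ctx arm
      = ∑ t ∈ Finset.range T, ∫ ω, (bestMean ν (ctx t ω) - armMean ν (ctx t ω) (arm t ω)) ∂P :=
        integral_finsetSum _ fun t ht => hRint t (Finset.mem_range.1 ht)
    _ ≤ ∑ t ∈ Finset.range T, ∫ ω, G t ω ∂P :=
        Finset.sum_le_sum fun t ht => hstep t (Finset.mem_range.1 ht)
    _ = ∫ ω, ∑ t ∈ Finset.range T, G t ω ∂P :=
        (integral_finsetSum _ fun t ht => hGint t (Finset.mem_range.1 ht)).symm
    _ ≤ ∫ _, (F * L * D + (2 * (T / D) + 2) * (4 * K + A * (1 + Real.log T)) : ℝ) ∂P :=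
        integral_mono_ae (integrable_finsetSum _ fun t ht => hGint t (Finset.mem_range.1 ht))
          (integrable_const _) hpath
    _ = _ := by simp

theorem pseudoRegret_le_rounds {mΩ : MeasurableSpace Ω} (P : Measure Ω) [IsProbabilityMeasure P]
    (hν : IsRewardModel ν) (T : ℕ) (ctx : ℕ → Ω → V) (arm : ℕ → Ω → Fin K) :
    pseudoRegret P ν T ctx arm ≤ T := by
  have h := norm_integral_le_of_norm_le_const (μ := P) (C := (T : ℝ))
    (f := fun ω => ∑ t ∈ Finset.range T, (bestMean ν (ctx t ω) - armMean ν (ctx t ω) (arm t ω)))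
    (Filter.Eventually.of_forall fun ω => by
      rw [Real.norm_eq_abs, abs_of_nonneg
        (Finset.sum_nonneg fun t _ => sub_nonneg.2 (armMean_le_bestMean (ctx t ω) (arm t ω)))]
      refine (Finset.sum_le_sum fun t _ => hν.gap_le_one (ctx t ω) (arm t ω)).trans ?_
      simp)
  rw [probReal_univ, mul_one] at h
  exact (le_abs_self _).trans h

end RegretBound

/-! ### Existence, length and cuts of a spine -/

section Spine

variable {V : Type u} [DecidableEq V] {G : SimpleGraph V}

/-- A walk can be extended by a detour along an unused edge at one of its vertices. -/
theorem exists_walk_insert_edge {r a b : V} (p : G.Walk r r) (ha : a ∈ p.support)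
    (hab : G.Adj a b) :
    ∃ q : G.Walk r r, ∀ e, q.edges.count e = p.edges.count e + if e = s(a, b) then 2 else 0 := by
  refine ⟨(p.takeUntil a ha).append
    (.cons hab (.cons hab.symm (p.dropUntil a ha))), fun e => ?_⟩
  have hp : p.edges.count e =
      (p.takeUntil a ha).edges.count e + (p.dropUntil a ha).edges.count e := by
    conv_lhs => rw [← p.take_spec ha]
    rw [SimpleGraph.Walk.edges_append, List.count_append]
  rw [hp, SimpleGraph.Walk.edges_append, List.count_append, SimpleGraph.Walk.edges_cons,
    SimpleGraph.Walk.edges_cons, List.count_cons, List.count_cons, Sym2.eq_swap (a := b)]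
  simp only [beq_iff_eq, eq_comm (a := s(a, b))]
  split_ifs <;> omega

/-- In a connected graph, a closed walk that misses an edge has a vertex incident to a missed
edge. -/
theorem exists_unused_edge_at_support (hG : G.Connected) {r : V} (p : G.Walk r r)
    {e : Sym2 V} (he : e ∈ G.edgeSet) (hep : e ∉ p.edges) :
    ∃ a b, a ∈ p.support ∧ G.Adj a b ∧ s(a, b) ∉ p.edges := by
  induction e with | _ x y => ?_
  by_cases hx : x ∈ p.support
  · exact ⟨x, y, hx, he, hep⟩
  · obtain ⟨q⟩ := hG.preconnected r x
    obtain ⟨d, -, h1, h2⟩ := q.exists_boundary_dart {v | v ∈ p.support} p.start_mem_support hx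
    exact ⟨d.fst, d.snd, h1, d.adj, fun h => h2 (p.snd_mem_support_of_mem_edges h)⟩

/-- Induction on the number of missed edges: a detour along a missed edge at a visited vertex raises
its count from `0` to `2` and leaves the other counts unchanged. Connectedness suffices. -/
theorem exists_closed_walk_count_edges_eq_two [Fintype V] (hG : G.Connected) (r : V) :
    ∃ p : G.Walk r r, ∀ e ∈ G.edgeSet, p.edges.count e = 2 := by
  classical
  have key : ∀ m : ℕ, ∀ p : G.Walk r r, (∀ e, p.edges.count e = 0 ∨ p.edges.count e = 2) →
      (G.edgeFinset.filter fun e => e ∉ p.edges).card = m →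
      ∃ p : G.Walk r r, ∀ e ∈ G.edgeSet, p.edges.count e = 2 := by
    intro m
    induction m using Nat.strong_induction_on with | _ m ih => ?_
    intro p hp hm
    by_cases h : ∃ e ∈ G.edgeSet, e ∉ p.edges
    · obtain ⟨e, he, hep⟩ := h
      obtain ⟨a, b, ha, hab, habp⟩ := exists_unused_edge_at_support hG p he hep
      obtain ⟨q, hq⟩ := exists_walk_insert_edge p ha hab
      refine ih _ ?_ q (fun e => ?_) rfl
      · rw [← hm]
        refine Finset.card_lt_card (Finset.ssubset_iff_of_subset ?_ |>.2 ⟨s(a, b), ?_, ?_⟩)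
        · intro e he
          simp only [Finset.mem_filter, ← List.count_eq_zero, hq] at he ⊢
          exact ⟨he.1, by omega⟩
        · simpa using ⟨hab, habp⟩
        · simp [← List.count_eq_zero, hq]
      · rw [hq]
        split_ifs with h
        · rw [h, List.count_eq_zero.2 habp]
          simp
        · exact hp e
    · push Not at h
      exact ⟨p, fun e he => (hp e).resolve_left fun h0 => List.count_eq_zero.1 h0 (h e he)⟩
  exact key _ .nil (fun e => Or.inl (by simp)) rfl

theorem nonempty_spine [Fintype V] (hG : G.Connected) : Nonempty (Spine G) := by
  obtain ⟨r⟩ := hG.nonempty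
  obtain ⟨p, hp⟩ := exists_closed_walk_count_edges_eq_two hG r
  -- A path to an unvisited vertex would leave the support through an edge, but every edge is
  -- crossed.
  have hsupp : ∀ c, c ∈ p.support := by
    intro c
    by_contra hc
    obtain ⟨q⟩ := hG.preconnected r c
    obtain ⟨d, -, -, h2⟩ := q.exists_boundary_dart {v | v ∈ p.support} p.start_mem_support hc
    have hd : s(d.fst, d.snd) ∈ p.edges := by
      rw [← List.count_pos_iff, hp _ d.adj]
      norm_num
    exact h2 (p.snd_mem_support_of_mem_edges hd)
  choose pos hpos using fun c => SimpleGraph.Walk.mem_support_iff_exists_getVert.1 (hsupp c)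
  exact ⟨⟨r, p, hp, pos, fun c => (hpos c).2, fun c => (hpos c).1⟩⟩

-- Each label change along the walk is a traversal of a cut edge, so changes are counted by
-- traversals.
open Classical in
theorem card_cuts_walk_le {Λ : Type v} (y : V → Λ) (C : Finset (Sym2 V))
    (hC : ∀ a b, G.Adj a b → y a ≠ y b → s(a, b) ∈ C) {r t : V} (p : G.Walk r t) :
    ((Finset.range p.length).filter fun x => y (p.getVert x) ≠ y (p.getVert (x + 1))).card ≤
      ∑ e ∈ C, p.edges.count e := by
  rw [Finset.card_filter]
  induction p with
  | nil => simp
  | @cons a b c hab p ih =>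
    rw [SimpleGraph.Walk.length_cons, Finset.sum_range_succ', SimpleGraph.Walk.edges_cons]
    simp only [List.count_cons, Finset.sum_add_distrib, SimpleGraph.Walk.getVert_cons_succ,
      SimpleGraph.Walk.getVert_zero, beq_iff_eq, Finset.sum_ite_eq]
    refine add_le_add (le_trans (le_of_eq ?_) ih) ?_
    · rfl
    · by_cases h : y a = y b
      · simp [h]
      · simp [h, hC a b hab h]

/-- A tree with `n` vertices has `n - 1` edges, each crossed twice; hence the spine needs at most
`Nat.clog 2 (2 * n)` levels. -/
theorem Spine.length_walk [Fintype V] (hG : G.IsTree) (S : Spine G) :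
    S.walk.length + 2 = 2 * Fintype.card V := by
  classical
  have h1 := hG.card_edgeFinset
  have h2 : ∑ e ∈ G.edgeFinset, (S.walk.edges : Multiset (Sym2 V)).count e =
      Multiset.card (S.walk.edges : Multiset (Sym2 V)) :=
    Multiset.sum_count_eq_card fun e he => by
      rw [SimpleGraph.mem_edgeFinset]
      exact S.walk.edges_subset_edgeSet he
  simp only [Multiset.coe_count, Multiset.coe_card, SimpleGraph.Walk.length_edges] at h2
  rw [Finset.sum_congr rfl fun e he => S.count_edge e (SimpleGraph.mem_edgeFinset.1 he),
    Finset.sum_const, smul_eq_mul] at h2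
  omega

open Classical in
theorem Spine.card_cuts_le [Finite V] {Λ : Type v} (y : V → Λ) (S : Spine G) :
    ((Finset.range S.walk.length).filter fun x =>
      y (S.walk.getVert x) ≠ y (S.walk.getVert (x + 1))).card ≤ 2 * cutsize G y := by
  cases nonempty_fintype V
  have hfin : {e : Sym2 V | ∃ c c', e = s(c, c') ∧ G.Adj c c' ∧ y c ≠ y c'}.Finite := Set.toFinite _
  refine (card_cuts_walk_le y hfin.toFinset
    (fun a b hab h => by simpa using ⟨a, b, Or.inl ⟨rfl, rfl⟩, hab, h⟩) S.walk).trans ?_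
  rw [cutsize, Set.ncard_eq_toFinset_card _ hfin, mul_comm, ← smul_eq_mul]
  refine Finset.sum_le_card_nsmul _ _ _ fun e he => ?_
  obtain ⟨c, c', rfl, h, -⟩ := hfin.mem_toFinset.1 he
  exact (S.count_edge _ h).le

end Spine

/-! ### Cuts on the line, tuning of `D`, and the theorem -/

open Classical in
theorem card_cuts_pathGraph_le {n : ℕ} {Λ : Type v} (y : Fin n → Λ) (z : ℕ → Λ)
    (hz : ∀ c : Fin n, z c = y c) :
    ((Finset.range (n - 1)).filter fun x => z x ≠ z (x + 1)).card ≤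
      cutsize (SimpleGraph.pathGraph n) y := by
  rcases n with _ | n
  · simp
  have hv : ∀ x ∈ Finset.range n, z x ≠ z (x + 1) →
      (SimpleGraph.pathGraph (n + 1)).Adj (Fin.ofNat (n + 1) x) (Fin.ofNat (n + 1) (x + 1)) ∧
        y (Fin.ofNat (n + 1) x) ≠ y (Fin.ofNat (n + 1) (x + 1)) := by
    intro x hx h
    have hx' := Finset.mem_range.1 hx
    have e1 : x % (n + 1) = x := Nat.mod_eq_of_lt (by omega)
    have e2 : (x + 1) % (n + 1) = x + 1 := Nat.mod_eq_of_lt (by omega)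
    rw [SimpleGraph.pathGraph_adj, ← hz, ← hz]
    simp only [Fin.val_ofNat, e1, e2]
    exact ⟨Or.inl trivial, h⟩
  rw [cutsize, ← Set.ncard_coe_finset]
  refine Set.ncard_le_ncard_of_injOn
    (fun x => s(Fin.ofNat (n + 1) x, Fin.ofNat (n + 1) (x + 1))) ?_ ?_ (Set.toFinite _)
  · intro x hx
    have hx := Finset.mem_filter.1 (Finset.mem_coe.1 hx)
    exact ⟨_, _, rfl, hv x hx.1 hx.2⟩
  · intro x hx x' hx' h
    have hx := Finset.mem_range.1 (Finset.mem_filter.1 (Finset.mem_coe.1 hx)).1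
    have hx' := Finset.mem_range.1 (Finset.mem_filter.1 (Finset.mem_coe.1 hx')).1
    simp only [Nat.add_sub_cancel] at hx hx'
    have e1 : ∀ x < n, x % (n + 1) = x := fun x hx => Nat.mod_eq_of_lt (by omega)
    have e2 : ∀ x < n, (x + 1) % (n + 1) = x + 1 := fun x hx => Nat.mod_eq_of_lt (by omega)
    simp only [Sym2.eq_iff, Fin.ext_iff, Fin.val_ofNat, e1 _ hx, e1 _ hx', e2 _ hx, e2 _ hx'] at h
    omega

/-- Pseudo-regret of the hierarchical algorithm on positions whose labels `z` change at most `F`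
times. -/
theorem hierPolicy_pseudoRegret_le_of_cuts {V : Type u} [Finite V] {K : ℕ} [NeZero K] {Λ : Type v}
    {ν : V → Fin K → Measure ℝ} {y : V → Λ} {δ : ℝ} (hν : IsRewardModel ν)
    (hy : RespectsLabels ν y) (hE : IsEasy ν δ) (hδ : 0 < δ) {D L F T N : ℕ} {pos : V → ℕ}
    (hL : 1 ≤ L) (hpos : ∀ c, pos c ≤ N) (hN : N < 2 ^ L) (hD : 1 ≤ D) (z : ℕ → Λ)
    (hz : ∀ c, z (pos c) = y c) (cuts : Finset ℕ) (hcard : cuts.card ≤ F)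
    (hcuts : ∀ x < N, z x ≠ z (x + 1) → x ∈ cuts)
    {Ω : Type w} {mΩ : MeasurableSpace Ω} {P : Measure Ω} [IsProbabilityMeasure P]
    {ℱ : Filtration ℕ mΩ} {ctx : ℕ → Ω → V} {arm : ℕ → Ω → Fin K} {rew : ℕ → Ω → ℝ}
    (H : IsInteraction P ℱ ν (hierPolicy D L pos) T ctx arm rew) :
    pseudoRegret P ν T ctx arm ≤ F * L * D +
      (2 * (T / D) + 2) * (4 * K + (121 * K / δ + 8) * (1 + Real.log T)) := by
  classical
  -- Only a change between two neighbours of the same block counts. Each cut thus spoils at most one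
  -- block per level, and none at the last level, where blocks are single positions.
  set mixed : ℕ → ℕ → Prop := fun p j =>
    ∃ x ∈ cuts, blockIndex L p x = j ∧ blockIndex L p (x + 1) = j with hmix
  refine hierPolicy_pseudoRegret_le hν hE hδ le_rfl hL (fun c => (hpos c).trans_lt hN) hD
    (mixed := mixed) (fun p => ?_) (fun j => ?_) (fun p c c' hm hcc => ?_) H
  · refine le_trans (Finset.card_le_card (t := cuts.image (blockIndex L p)) ?_)
      (Finset.card_image_le.trans hcard)
    intro j hj
    simp only [Finset.mem_filter] at hj
    obtain ⟨-, x, hx, h, -⟩ := hj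
    exact Finset.mem_image.2 ⟨x, hx, h⟩
  · rintro ⟨x, -, h1, h2⟩
    simp only [blockIndex, Nat.sub_self, pow_zero, Nat.div_one] at h1 h2
    omega
  · have hmono : ∀ {x x'}, x ≤ x' → blockIndex L p x ≤ blockIndex L p x' :=
      fun h => Nat.div_le_div_right h
    have hconst : ∀ c c' : V, ¬ mixed p (blockIndex L p (pos c)) →
        blockIndex L p (pos c) = blockIndex L p (pos c') → pos c ≤ pos c' →
        ∀ x, pos c ≤ x → x ≤ pos c' → z (pos c) = z x := by
      intro c c' hm hcc _ x hx
      induction x, hx using Nat.le_induction with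
      | base => exact fun _ => rfl
      | succ x hx ih =>
        intro hx'
        rw [ih (by omega)]
        by_contra hne
        have := hpos c'
        refine hm ⟨x, hcuts x (by omega) hne, ?_, ?_⟩
        · exact le_antisymm (hcc ▸ hmono (by omega)) (hmono hx)
        · exact le_antisymm (hcc ▸ hmono hx') (hmono (by omega))
    refine hy c c' ?_
    rw [← hz, ← hz]
    rcases le_total (pos c) (pos c') with h | h
    · exact hconst c c' hm hcc h _ h le_rfl
    · exact (hconst c' c (hcc ▸ hm) hcc.symm h _ h le_rfl).symm

/-- Here `X` stands for `√(KTf)`, `R` for `√(TK/f)`, `l` for `log (nT)` and `t` for `1 + log T`. The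
upper bound on `D` controls `f * D` by `b * X`, and the lower bound controls `T * K / D` by `X / a`.
-/
theorem regret_bound_arith {δ a b F L D T K f X R l t : ℝ} (hδ : 0 < δ) (ha : 0 < a) (hb : 0 < b)
    (hT : 1 ≤ T) (hK : 1 ≤ K) (hf : 1 ≤ f) (hD : 0 < D) (hL : 0 ≤ L) (hX : 0 < X)
    (hl : 0 < l) (hF : F ≤ 2 * f) (hLl : L ≤ 6 * l) (hfX : f ≤ X) (hKX : K ≤ X)
    (hXR : R * f = X) (hXX : X * X = T * K * f) (hDa : a * R ≤ D) (hDb : D ≤ b * max 1 R)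
    (ht : 1 ≤ t) (hlog1 : t ≤ 3 * l) :
    F * L * D + (2 * (T / D) + 2) * (4 * K + (121 * K / δ + 8) * t) ≤
      (12 * b + (2 / a + 2) * (12 + 121 / δ) * 3) * X * l := by
  have hfD : f * D ≤ b * X := by
    have h1 : f * max 1 R ≤ X := by
      rcases le_total 1 R with h | h
      · rw [max_eq_right h, mul_comm, hXR]
      · rw [max_eq_left h, mul_one]
        exact hfX
    calc f * D ≤ f * (b * max 1 R) := by gcongr
      _ = b * (f * max 1 R) := by ring
      _ ≤ b * X := by gcongr
  have hpart1 : F * L * D ≤ 12 * b * X * l := by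
    calc F * L * D ≤ 2 * f * (6 * l) * D := by gcongr
      _ = 12 * l * (f * D) := by ring
      _ ≤ 12 * l * (b * X) := by gcongr
      _ = _ := by ring
  have hTD : T / D * K ≤ X / a := by
    rw [div_mul_eq_mul_div, div_le_div_iff₀ hD ha]
    have : T * K * a = X * (a * R) := by
      have : X * R * f = T * K * f := by rw [mul_assoc, hXR, hXX]
      have := mul_right_cancel₀ (by positivity) this
      rw [← this]
      ring
    rw [this]
    gcongr
  have hinner : 4 * K + (121 * K / δ + 8) * t ≤
      K * ((12 + 121 / δ) * (3 * l)) := by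
    calc 4 * K + (121 * K / δ + 8) * t
        ≤ 4 * K * t + (121 * K / δ + 8 * K) * t := by
          have h1 : 4 * K * 1 ≤ 4 * K * t := by gcongr
          have h2 : (121 * K / δ + 8) * t ≤ (121 * K / δ + 8 * K) * t := by
            gcongr
            linarith
          linarith
      _ = K * ((12 + 121 / δ) * t) := by ring
      _ ≤ K * ((12 + 121 / δ) * (3 * l)) := by gcongr
  have hpart2 : (2 * (T / D) + 2) *
      (4 * K + (121 * K / δ + 8) * t) ≤
      (2 / a + 2) * (12 + 121 / δ) * 3 * X * l := by
    calc (2 * (T / D) + 2) * (4 * K + (121 * K / δ + 8) * t)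
        ≤ (2 * (T / D) + 2) * (K * ((12 + 121 / δ) * (3 * l))) := by gcongr
      _ = (2 * (T / D * K) + 2 * K) * ((12 + 121 / δ) * (3 * l)) := by ring
      _ ≤ (2 * (X / a) + 2 * X) * ((12 + 121 / δ) * (3 * l)) := by gcongr
      _ = _ := by ring
  linarith

/-- Tuning of the regret bound of the hierarchical algorithm. -/
theorem tuned_regret_le {δ a b reg : ℝ} (hδ : 0 < δ) (ha : 0 < a) (hb : 0 < b) {n K T D f F L : ℕ}
    (hn : 2 ≤ n) (hK : 1 ≤ K) (hf : 1 ≤ f) (hF : F ≤ 2 * f) (hL : L ≤ Nat.clog 2 (2 * n))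
    (hDa : a * √((T : ℝ) * K / f) ≤ D) (hDb : (D : ℝ) ≤ b * max 1 √((T : ℝ) * K / f))
    (htriv : reg ≤ T)
    (hreg : 1 ≤ D → reg ≤ F * L * D +
      (2 * (T / D) + 2) * (4 * K + (121 * K / δ + 8) * (1 + Real.log T))) :
    reg ≤ (12 * b + (2 / a + 2) * (12 + 121 / δ) * 3 + 2) * √((K : ℝ) * T * f) *
      Real.log ((n : ℝ) * T) := by
  -- For `T = 0` the claimed bound is `0`, and `D` may vanish. For `T > 0` the lower bound on `D`
  -- forces `1 ≤ D`.
  rcases Nat.eq_zero_or_pos T with rfl | hT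
  · simpa using htriv
  have hT1 : (1 : ℝ) ≤ T := by exact_mod_cast hT
  have hn2 : (2 : ℝ) ≤ n := by exact_mod_cast hn
  have hK1 : (1 : ℝ) ≤ K := by exact_mod_cast hK
  have hf1 : (1 : ℝ) ≤ f := by exact_mod_cast hf
  set X := √((K : ℝ) * T * f) with hX
  set R := √((T : ℝ) * K / f) with hR
  set l := Real.log ((n : ℝ) * T) with hl
  have hXsq : X ^ 2 = K * T * f := Real.sq_sqrt (by positivity)
  have hX0 : 0 < X := Real.sqrt_pos.2 (by positivity)
  have hR0 : 0 < R := Real.sqrt_pos.2 (by positivity)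
  have hXR : R * f = X := by
    have hRsq : R ^ 2 = T * K / f := Real.sq_sqrt (by positivity)
    rw [hX, eq_comm, Real.sqrt_eq_iff_mul_self_eq (by positivity) (by positivity)]
    have : R * f * (R * f) = R ^ 2 * f ^ 2 := by ring
    rw [this, hRsq]
    field_simp
  have hlog2 : (1 : ℝ) / 2 < Real.log 2 := by linarith [Real.log_two_gt_d9]
  have hl2 : Real.log 2 ≤ l := Real.log_le_log (by norm_num) (by nlinarith)
  have hlT : Real.log T ≤ l := Real.log_le_log (by linarith) (by nlinarith)
  have hlogT : 0 ≤ Real.log T := Real.log_nonneg hT1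
  have hl0 : 0 < l := by linarith
  clear_value X R l
  have hC0 : 0 ≤ 12 * b + (2 / a + 2) * (12 + 121 / δ) * 3 := by positivity
  -- If `T ≤ K * f`, the trivial bound `T` is at most `X`, hence at most `2 * X * l` as `l > 1 / 2`;
  -- this is the final `+ 2` of the constant. Otherwise `K` and `f` are at most `X`.
  rcases le_total (T : ℝ) (K * f) with hsmall | hbig
  · have hTX : (T : ℝ) ≤ X := by
      rw [hX]
      exact Real.le_sqrt_of_sq_le (by nlinarith)
    have h1 : (T : ℝ) ≤ 2 * X * l := by nlinarith
    have h2 : 0 ≤ (12 * b + (2 / a + 2) * (12 + 121 / δ) * 3) * X * l := by positivity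
    linarith
  · have hDpos : (0 : ℝ) < D := lt_of_lt_of_le (by positivity) hDa
    have hD1 : 1 ≤ D := by exact_mod_cast hDpos
    refine (hreg hD1).trans ?_
    -- From `(L - 1) * log 2 ≤ log (2 * n) ≤ 2 * l` and `log 2 > 1 / 2` one gets `L - 1 ≤ 4 * l`,
    -- and `1 ≤ 2 * l`.
    have hLl : (L : ℝ) ≤ 6 * l := by
      have hpow : 2 ^ (L - 1) ≤ 2 * n := by
        refine (Nat.pow_le_pow_right (by norm_num) (Nat.sub_le_sub_right hL 1)).trans ?_
        exact (Nat.pow_pred_clog_lt_self (by norm_num) (by omega)).le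
      have hpow' : (2 : ℝ) ^ (L - 1) ≤ 2 * n := by exact_mod_cast hpow
      have h1 := Real.log_le_log (by positivity) hpow'
      rw [Real.log_pow, Real.log_mul (by norm_num) (by positivity)] at h1
      have h2 : Real.log n ≤ l := by
        rw [hl]
        exact Real.log_le_log (by positivity) (by nlinarith)
      have h3 : (L : ℝ) ≤ ((L - 1 : ℕ) : ℝ) + 1 := by
        have : L ≤ L - 1 + 1 := by omega
        exact_mod_cast this
      have h4 : ((L - 1 : ℕ) : ℝ) * (1 / 2) ≤ ((L - 1 : ℕ) : ℝ) * Real.log 2 :=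
        mul_le_mul_of_nonneg_left hlog2.le (Nat.cast_nonneg _)
      linarith
    have hfT : (f : ℝ) ≤ T := by nlinarith
    have hfX : (f : ℝ) ≤ X := by
      rw [hX]
      refine Real.le_sqrt_of_sq_le ?_
      calc (f : ℝ) ^ 2 = 1 * f * f := by ring
        _ ≤ K * T * f := by gcongr
    have hKT : (K : ℝ) ≤ T := by nlinarith
    have hKX : (K : ℝ) ≤ X := by
      rw [hX]
      refine Real.le_sqrt_of_sq_le ?_
      calc (K : ℝ) ^ 2 = K * K * 1 := by ring
        _ ≤ K * T * f := by gcongr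
    have h1 := regret_bound_arith hδ ha hb hT1 hK1 hf1 hDpos (Nat.cast_nonneg L) hX0 hl0
      (by exact_mod_cast hF : (F : ℝ) ≤ 2 * f) hLl hfX hKX hXR (by rw [← sq, hXsq]; ring) hDa hDb
      (by linarith) (by linarith : 1 + Real.log T ≤ 3 * l)
    have : 0 ≤ 2 * X * l := by positivity
    linarith

theorem two_le_card_of_cutsize_pos {V : Type u} [Fintype V] {Λ : Type v} {G : SimpleGraph V}
    {y : V → Λ} (h : 1 ≤ cutsize G y) : 2 ≤ Fintype.card V := by
  by_contra hc
  have := Fintype.card_le_one_iff_subsingleton.1 (show Fintype.card V ≤ 1 by omega)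
  have he : {e : Sym2 V | ∃ c c', e = s(c, c') ∧ G.Adj c c' ∧ y c ≠ y c'} = ∅ := by
    refine Set.eq_empty_of_forall_notMem ?_
    rintro _ ⟨c, c', -, hadj, -⟩
    exact hadj.ne (Subsingleton.elim _ _)
  rw [cutsize, he, Set.ncard_empty] at h
  omega

theorem mainTheorem2 (δ a b : ℝ) (hδ : 0 < δ) (ha : 0 < a) (hb : 0 < b) :
    ∃ C : ℝ, 0 < C ∧
      -- line graphs
      (∀ (n K T D f : ℕ) [NeZero K] (Λ : Type v) (y : Fin n → Λ) (ν : Fin n → Fin K → Measure ℝ),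
        IsRewardModel ν → RespectsLabels ν y → IsEasy ν δ →
        cutsize (SimpleGraph.pathGraph n) y = f → 1 ≤ f →
        a * √((T : ℝ) * K / f) ≤ D → (D : ℝ) ≤ b * max 1 √((T : ℝ) * K / f) →
        ∀ (Ω : Type w) [mΩ : MeasurableSpace Ω] (P : Measure Ω) [IsProbabilityMeasure P]
          (ℱ : Filtration ℕ mΩ) (ctx : ℕ → Ω → Fin n) (arm : ℕ → Ω → Fin K) (rew : ℕ → Ω → ℝ),
          IsInteraction P ℱ ν (linePolicy n K D) T ctx arm rew →
          pseudoRegret P ν T ctx arm ≤ C * √((K : ℝ) * T * f) * Real.log ((n : ℝ) * T)) ∧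
      -- trees
      (∀ (V : Type u) [Fintype V] [DecidableEq V] (G : SimpleGraph V), G.IsTree →
        Nonempty (Spine G) ∧
        ∀ (S : Spine G) (K T D f : ℕ) [NeZero K] (Λ : Type v) (y : V → Λ)
          (ν : V → Fin K → Measure ℝ),
        IsRewardModel ν → RespectsLabels ν y → IsEasy ν δ →
        cutsize G y = f → 1 ≤ f →
        a * √((T : ℝ) * K / f) ≤ D → (D : ℝ) ≤ b * max 1 √((T : ℝ) * K / f) →
        ∀ (Ω : Type w) [mΩ : MeasurableSpace Ω] (P : Measure Ω) [IsProbabilityMeasure P]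
          (ℱ : Filtration ℕ mΩ) (ctx : ℕ → Ω → V) (arm : ℕ → Ω → Fin K) (rew : ℕ → Ω → ℝ),
          IsInteraction P ℱ ν (treePolicy S K D) T ctx arm rew →
          pseudoRegret P ν T ctx arm ≤
            C * √((K : ℝ) * T * f) * Real.log ((Fintype.card V : ℝ) * T)) := by
  classical
  refine ⟨12 * b + (2 / a + 2) * (12 + 121 / δ) * 3 + 2, by positivity, ?_, ?_⟩
  · intro n K T D f _ Λ y ν hν hy hE hcut hf hDa hDb Ω mΩ P _ ℱ ctx arm rew H
    have hn : 2 ≤ n := by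
      have := two_le_card_of_cutsize_pos (hcut.symm ▸ hf)
      rwa [Fintype.card_fin] at this
    refine tuned_regret_le hδ ha hb hn (NeZero.one_le) hf (F := f) (L := Nat.clog 2 n) (by omega)
      (Nat.clog_mono_right 2 (by omega)) hDa hDb (pseudoRegret_le_rounds P hν T ctx arm)
      fun hD => ?_
    -- The values beyond the line are irrelevant, since changes are only examined before position `n
    -- - 1`.
    set z : ℕ → Λ := fun x => if h : x < n then y ⟨x, h⟩ else y ⟨0, by omega⟩ with hz
    have hzy : ∀ c : Fin n, z c = y c := fun c => by simp [hz]
    refine hierPolicy_pseudoRegret_le_of_cuts hν hy hE hδ (N := n - 1)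
      (Nat.clog_pos (by norm_num) hn) (fun c => by omega) ?_ hD z hzy _
      ((card_cuts_pathGraph_le y z hzy).trans hcut.le) (fun x hx h => ?_) H
    · have := Nat.le_pow_clog (b := 2) (by norm_num) n
      omega
    · exact Finset.mem_filter.2 ⟨Finset.mem_range.2 hx, h⟩
  · intro V _ _ G hG
    refine ⟨nonempty_spine hG.connected, ?_⟩
    intro S K T D f _ Λ y ν hν hy hE hcut hf hDa hDb Ω mΩ P _ ℱ ctx arm rew H
    have hn : 2 ≤ Fintype.card V := two_le_card_of_cutsize_pos (hcut.symm ▸ hf)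
    have hlen := S.length_walk hG
    refine tuned_regret_le hδ ha hb hn (NeZero.one_le) hf (F := 2 * f)
      (L := Nat.clog 2 (S.walk.length + 1)) le_rfl (Nat.clog_mono_right 2 (by omega)) hDa hDb
      (pseudoRegret_le_rounds P hν T ctx arm) fun hD => ?_
    refine hierPolicy_pseudoRegret_le_of_cuts hν hy hE hδ (N := S.walk.length)
      (Nat.clog_pos (by norm_num) (by omega)) S.pos_le ?_ hD (fun x => y (S.walk.getVert x))
      (fun c => by rw [S.getVert_pos]) _ ((S.card_cuts_le y).trans (by rw [hcut]))
      (fun x hx h => ?_) H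
    · have := Nat.le_pow_clog (b := 2) (by norm_num) (S.walk.length + 1)
      omega
    · exact Finset.mem_filter.2 ⟨Finset.mem_range.2 hx, h⟩
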